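/- Manifolds are finite-dimensional, smooth ($C^\infty$), Hausdorff, second countable and without boundary. A smooth quasiloopoid $G\rightrightarrows M$ consists of a manifold $G$, an embedded submanifold $\varepsilon: M\hookrightarrow G$ of units, surjective submersions $\alpha,\beta:G\to M$ (target and source) and a smooth map $m:G^{(2)}\to G$, $m(g,h)=gh$, where $G^{(2)}=\{(g,h)\in G\times G:\beta(g)=\alpha(h)\}$ is a closed embedded submanifold of $G\times G$, such that: - for all $g\in G$, the products $g\,\beta(g)$ and $\alpha(g)\,g$ are defined and equal to $g$ (units being viewed as elements of $G$ through $\varepsilon$); - the translations $l_g:\alpha^{-1}(\beta(g))\to G$, $l_g(h)=gh$, and $r_h:\beta^{-1}(\alpha(h))\to G$, $r_h(g)=gh$, are injective immersions. It is a smooth loopoid if moreover - $(xy)z=x(yz)$ whenever one of $x,y,z$ is a unit (if one side is defined, then so is the other, and they are equal); - the translations are diffeomorphisms between fibres, $l_g:\alpha^{-1}(\beta(g))\to\alpha^{-1}(\alpha(g))$ and $r_h:\beta^{-1}(\alpha(h))\to\beta^{-1}(\beta(h))$. It is an I.P. loopoid with inversion $\iota$ if moreover $\iota:G\to G$, $g\mapsto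 g^{-1}$, is a diffeomorphism such that, for all $(g,h)\in G^{(2)}$, the products $g^{-1}(gh)$ and $(gh)h^{-1}$ are defined and $g^{-1}(gh)=h$, $(gh)h^{-1}=g$. Theorem. Let $G\rightrightarrows M$ be a smooth loopoid. Then $TG$ is a smooth loopoid over $TM$, with units $T\varepsilon:TM\to TG$, target and source maps $T\alpha,T\beta:TG\to TM$, and multiplication $Tm:T(G^{(2)})\to TG$. Here $T(G^{(2)})$ is identified, through the tangent maps of the two projections $G^{(2)}\to G$, with the closed embedded submanifold $(TG)^{(2)}=\{(X,Y)\in TG\times TG: T\beta(X)=T\alpha(Y)\}$ of $TG\times TG$; that this map is an embedding with this image is part of the assertion. If $G$ is an I.P. loopoid with inversion $\iota$, then $TG$, with this structure, is an I.P. loopoid with inversion $T\iota$. -/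

import Mathlib

open scoped ContDiff Manifold
open Set

/-! Smooth loopoids.

Throughout, the manifold `G⁽²⁾ = {(g, h) | β g = α h}` of composable pairs is represented by a
manifold `P` together with its two projections `p₁, p₂ : P → G`: the map `(p₁, p₂) : P → G × G` is
required to be a smooth closed embedding with image exactly `G⁽²⁾`.  As the smooth structure of an
embedded submanifold is unique, this is the same as saying that `G⁽²⁾` is a closed embedded
submanifold, `P` being that submanifold.  The multiplication is a map `m : P → G`.
The submanifold of units is represented by its embedding `ε : M → G`. -/

/-- The multiplication relation: `(g, h)` is a composable pair and `g h = k`. -/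
def MulRel {G P : Type*} (p₁ p₂ m : P → G) (g h k : G) : Prop :=
  ∃ p : P, p₁ p = g ∧ p₂ p = h ∧ m p = k

/-- `f` restricts to a diffeomorphism from the subset `A` onto the subset `B` of the manifold `X`:
a bijection which is smooth on `A`, with inverse smooth on `B`.  It is applied only to fibres of
submersions, which are embedded submanifolds. On an embedded submanifold, smoothness of a map
in the sense of `ContMDiffOn` (for a subset of the ambient manifold) is the
same as smoothness for the submanifold structure. -/
def RestrictsToDiffeo {E H X : Type*} [NormedAddCommGroup E] [NormedSpace ℝ E]
    [TopologicalSpace H] (I : ModelWithCorners ℝ E H) [TopologicalSpace X] [ChartedSpace H X]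
    (f : X → X) (A B : Set X) : Prop :=
  MapsTo f A B ∧ ContMDiffOn I I ∞ f A ∧
    ∃ f' : X → X, MapsTo f' B A ∧ InvOn f' f A B ∧ ContMDiffOn I I ∞ f' B

section

variable {EG HG G EM HM M EP HP P : Type*}
  [NormedAddCommGroup EG] [NormedSpace ℝ EG] [TopologicalSpace HG]
  [NormedAddCommGroup EM] [NormedSpace ℝ EM] [TopologicalSpace HM]
  [NormedAddCommGroup EP] [NormedSpace ℝ EP] [TopologicalSpace HP]
  (IG : ModelWithCorners ℝ EG HG) (IM : ModelWithCorners ℝ EM HM) (IP : ModelWithCorners ℝ EP HP)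
  [TopologicalSpace G] [ChartedSpace HG G] [IsManifold IG ∞ G]
  [TopologicalSpace M] [ChartedSpace HM M] [IsManifold IM ∞ M]
  [TopologicalSpace P] [ChartedSpace HP P] [IsManifold IP ∞ P]

/-- Smooth quasiloopoid `G ⇉ M` with target `α`, source `β`, units `ε : M → G`, manifold of
composable pairs `(p₁, p₂) : P → G × G` and multiplication `m : P → G`. -/
structure IsSmoothQuasiloopoid (α β : G → M) (ε : M → G) (p₁ p₂ m : P → G) : Prop where
  t2_total : T2Space G
  secondCountable_total : SecondCountableTopology G
  t2_base : T2Space M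
  secondCountable_base : SecondCountableTopology M
  target_surjective : Function.Surjective α
  target_submersion : Manifold.IsSubmersion IG IM ∞ α
  source_surjective : Function.Surjective β
  source_submersion : Manifold.IsSubmersion IG IM ∞ β
  units_embedding : Manifold.IsSmoothEmbedding IM IG ∞ ε
  /-- the composable pairs form a closed embedded submanifold of `G × G` -/
  comp_embedding : Manifold.IsSmoothEmbedding IP (IG.prod IG) ∞ (fun p => (p₁ p, p₂ p))
  comp_closed : IsClosed {x : G × G | β x.1 = α x.2}
  /-- the product `g h` is defined if and only if `β g = α h` -/
  comp_range : range (fun p => (p₁ p, p₂ p)) = {x : G × G | β x.1 = α x.2}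
  mul_smooth : ContMDiff IP IG ∞ m
  /-- `g β(g)` is defined and equal to `g` -/
  mul_source : ∀ g : G, MulRel p₁ p₂ m g (ε (β g)) g
  /-- `α(h) h` is defined and equal to `h` -/
  target_mul : ∀ h : G, MulRel p₁ p₂ m (ε (α h)) h h
  /-- left translations are injective -/
  left_injective : ∀ p q : P, p₁ p = p₁ q → m p = m q → p₂ p = p₂ q
  /-- right translations are injective -/
  right_injective : ∀ p q : P, p₂ p = p₂ q → m p = m q → p₁ p = p₁ q
  /-- The left translation `l_g` by `g` is an immersion of the `α`-fibre over `β g`: at the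
  composable pair `p = (g, h)`, the vectors `v` killed by the derivative of `p₁` are the pairs
  `(0, w)` with `w` tangent to that fibre at `h`, and on them the derivative of `m` is
  the derivative of `l_g`. -/
  left_immersion : ∀ (p : P) (v : TangentSpace IP p),
    mfderiv IP IG p₁ p v = 0 → mfderiv IP IG m p v = 0 → v = 0
  /-- right translations are immersions of the `β`-fibres -/
  right_immersion : ∀ (p : P) (v : TangentSpace IP p),
    mfderiv IP IG p₂ p v = 0 → mfderiv IP IG m p v = 0 → v = 0

/-- Smooth loopoid: a smooth quasiloopoid with unities associativity, all of whose translations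
are diffeomorphisms between the fibres. -/
structure IsSmoothLoopoid (α β : G → M) (ε : M → G) (p₁ p₂ m : P → G) : Prop extends
    IsSmoothQuasiloopoid IG IM IP α β ε p₁ p₂ m where
  /-- `(x y) z = x (y z)` if one of `x, y, z` is a unit: if one side makes sense then so does the
  other one, and they are equal -/
  units_assoc : ∀ x y z : G, (x ∈ range ε ∨ y ∈ range ε ∨ z ∈ range ε) → ∀ k : G,
    (∃ u, MulRel p₁ p₂ m x y u ∧ MulRel p₁ p₂ m u z k) ↔
      (∃ v, MulRel p₁ p₂ m y z v ∧ MulRel p₁ p₂ m x v k)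
  /-- `l_g : α⁻¹(β g) → α⁻¹(α g)`, `h ↦ g h`, is a diffeomorphism -/
  left_diffeo : ∀ g : G, ∃ l : G → G, (∀ h k, MulRel p₁ p₂ m g h k → l h = k) ∧
    RestrictsToDiffeo IG l (α ⁻¹' {β g}) (α ⁻¹' {α g})
  /-- `r_h : β⁻¹(α h) → β⁻¹(β h)`, `g ↦ g h`, is a diffeomorphism -/
  right_diffeo : ∀ h : G, ∃ r : G → G, (∀ g k, MulRel p₁ p₂ m g h k → r g = k) ∧
    RestrictsToDiffeo IG r (β ⁻¹' {α h}) (β ⁻¹' {β h})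

/-- `ι` is a smooth inverse: a diffeomorphism of `G` such that `g⁻¹ (g h) = h` and
`(g h) h⁻¹ = g` (all the products being defined) for all composable pairs `(g, h)`. -/
structure IsSmoothInverse (p₁ p₂ m : P → G) (ι : G → G) : Prop where
  diffeo : ∃ Φ : G ≃ₘ⟮IG, IG⟯ G, ⇑Φ = ι
  inv_mul_cancel_left : ∀ g h k : G, MulRel p₁ p₂ m g h k → MulRel p₁ p₂ m (ι g) k h
  mul_inv_cancel_right : ∀ g h k : G, MulRel p₁ p₂ m g h k → MulRel p₁ p₂ m k (ι h) g

/-- An I.P. loopoid with inversion `ι`: a smooth loopoid with the inverse property. -/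
structure IsIPLoopoid (α β : G → M) (ε : M → G) (p₁ p₂ m : P → G) (ι : G → G) : Prop extends
    IsSmoothLoopoid IG IM IP α β ε p₁ p₂ m, IsSmoothInverse IG p₁ p₂ m ι

end

/-!
The tangent functor turns the structure maps of a loopoid, and the identities between them, into
those of its tangent bundle. Three points need an argument.

*Fibre products.* The manifold `P` of composable pairs is the fibre product of `β` and `α`. Since
`α` is a submersion, a pair `(X, Y)` with `Tβ X = Tα Y` is tangent to `P`: a local trivialization
of `α` yields a smooth retraction of `G × G` onto the fibre product near the given point, whose
derivative fixes `(X, Y)` (`IsSmoothFibreProduct.exists_tangent_lift`). Hence `TP` is the fibre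
product of `Tβ` and `Tα` (`IsSmoothFibreProduct.tangentMap`). Embeddings are handled through
smooth local inverses (`HasSmoothLocalInverses`), a condition which passes to tangent maps by the
chain rule; the normal forms of immersions and submersions pass to tangent maps in the charts of
the tangent bundle induced by arbitrary charts of the base (`tangentMap_eqOn_tangentChart`).

*Translations.* That each `l_g` is a diffeomorphism of fibres does not by itself say that `l_g⁻¹`
depends smoothly on `g`, which is what the tangent bundle requires. However the derivative of
`(p₁, m)` is injective, the translations being immersions, and it is onto the pairs `(X, K)` with
`Tα X = Tα K` (`IsSmoothLoopoid.exists_tangent_left_quotient`): a vector over `X` can be corrected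
by one tangent to a fibre, where `l_g` is a diffeomorphism. By the inverse function theorem
`(p₁, m)` presents `P` as the fibre product of `α` with itself
(`IsSmoothLoopoid.isSmoothFibreProduct_left`). Taking tangents, `(Tp₁, Tm)` presents `TP` as the
fibre product of `Tα` with itself, and this says that the left translations of `TG` are injective
immersions and diffeomorphisms between fibres (`IsSmoothFibreProduct.exists_restrictsToDiffeo`).
Right translations are left translations of the opposite loopoid (`IsSmoothLoopoid.op`).

*Identities.* An identity `a(x) b(x) = c(x)` between smooth maps passes to tangent maps, because
`x ↦ (a(x), b(x))` is a smooth map into `P` (`IsSmoothFibreProduct.mulRel_tangentMap`); this gives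
the laws of units and of the inversion. Unities associativity, which involves a condition on two
products, amounts to `α (g h) = α g` and `β (g h) = β h`
(`IsSmoothQuasiloopoid.units_assoc_of_target_mul`), identities between maps on `P`.
-/

/-! ### Tangent maps and maps with smooth local inverses -/

section SmoothLocalInverses

open Filter Topology

variable {E H M E' H' N E'' H'' N' : Type*}
  [NormedAddCommGroup E] [NormedSpace ℝ E] [TopologicalSpace H]
  [NormedAddCommGroup E'] [NormedSpace ℝ E'] [TopologicalSpace H']
  [NormedAddCommGroup E''] [NormedSpace ℝ E''] [TopologicalSpace H'']
  {I : ModelWithCorners ℝ E H} {J : ModelWithCorners ℝ E' H'} {J' : ModelWithCorners ℝ E'' H''}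
  [TopologicalSpace M] [ChartedSpace H M]
  [TopologicalSpace N] [ChartedSpace H' N]
  [TopologicalSpace N'] [ChartedSpace H'' N']

theorem tangentMap_congr_of_eventuallyEq {f g : M → N} {X : TangentBundle I M}
    (h : f =ᶠ[𝓝 X.1] g) : tangentMap I J f X = tangentMap I J g X := by
  have e := h.eq_of_nhds
  have e' := h.mfderiv_eq (I := I) (I' := J)
  apply Bundle.TotalSpace.ext e
  exact heq_of_eq (DFunLike.congr_fun e' X.2)

theorem ContMDiffAt.eventually_mdifferentiableAt [IsManifold I ∞ M] [IsManifold J ∞ N]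
    {f : M → N} {x : M}
    (hf : ContMDiffAt I J ∞ f x) : ∀ᶠ y in 𝓝 x, MDifferentiableAt I J f y := by
  have h1 : ContMDiffAt I J 1 f x := hf.of_le (by simp)
  filter_upwards [contMDiffAt_iff_contMDiffAt_nhds (by simp) |>.1 h1] with y hy using
    hy.mdifferentiableAt (by simp)

theorem tendsto_tangentBundle_proj (X : TangentBundle I M) [IsManifold I ∞ M] :
    Tendsto (fun Y : TangentBundle I M => Y.1) (𝓝 X) (𝓝 X.1) :=
  (FiberBundle.continuous_proj E (TangentSpace I : M → Type _)).continuousAt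

/-- The tangent map of a map that is smooth at a point is smooth at all vectors over that point. -/
theorem ContMDiffAt.contMDiffAt_tangentMap [IsManifold I ∞ M] [IsManifold J ∞ N]
    {f : M → N} {X : TangentBundle I M}
    (hf : ContMDiffAt I J ∞ f X.1) :
    ContMDiffAt I.tangent J.tangent ∞ (tangentMap I J f) X := by
  -- smoothness at a point propagates to a neighbourhood only for finite orders of differentiability
  rw [contMDiffAt_infty]
  intro n
  have h1 : ContMDiffAt I J (n + 1 : ℕ) f X.1 := hf.of_le (by exact_mod_cast le_top)
  obtain ⟨u, hu, huo, hXu⟩ :=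
    eventually_nhds_iff.1 (contMDiffAt_iff_contMDiffAt_nhds (by simp) |>.1 h1)
  have hfu : ContMDiffOn I J (n + 1 : ℕ) f u := fun y hy => (hu y hy).contMDiffWithinAt
  have h2 := hfu.contMDiffOn_tangentMapWithin (m := n) (by norm_cast) huo.uniqueMDiffOn
  have ho : IsOpen (Bundle.TotalSpace.proj ⁻¹' u : Set (TangentBundle I M)) :=
    huo.preimage (FiberBundle.continuous_proj E (TangentSpace I : M → Type _))
  refine ((h2 X hXu).contMDiffAt (ho.mem_nhds hXu)).congr_of_eventuallyEq ?_
  filter_upwards [ho.mem_nhds hXu] with Y hY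
  exact (tangentMapWithin_eq_tangentMap (huo.uniqueMDiffOn _ hY)
    ((hu _ hY).mdifferentiableAt (by simp))).symm

theorem ContMDiff.tangentMap_infty [IsManifold I ∞ M] [IsManifold J ∞ N]
    {f : M → N} (hf : ContMDiff I J ∞ f) :
    ContMDiff I.tangent J.tangent ∞ (tangentMap I J f) :=
  fun _ => (hf _).contMDiffAt_tangentMap

theorem equivTangentBundleProd_tangentMap_prodMk {f : M → N} {g : M → N'} {X : TangentBundle I M}
    (hf : MDifferentiableAt I J f X.1) (hg : MDifferentiableAt I J' g X.1) :
    equivTangentBundleProd J N J' N' (tangentMap I (J.prod J') (fun x => (f x, g x)) X) =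
      (tangentMap I J f X, tangentMap I J' g X) := by
  simp only [tangentMap, equivTangentBundleProd, Equiv.coe_fn_mk]
  rw [mfderiv_prodMk hf hg]
  rfl

theorem tangentMap_prodMk {f : M → N} {g : M → N'} {X : TangentBundle I M}
    (hf : MDifferentiableAt I J f X.1) (hg : MDifferentiableAt I J' g X.1) :
    tangentMap I (J.prod J') (fun x => (f x, g x)) X =
      (equivTangentBundleProd J N J' N').symm (tangentMap I J f X, tangentMap I J' g X) := by
  rw [← equivTangentBundleProd_tangentMap_prodMk hf hg, Equiv.symm_apply_apply]

variable (I J) in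
/-- Near each value `f x`, a smooth map `r` on the ambient manifold recovers the preimages under
`f` of the points of the range of `f`. For a smooth map `f` between finite-dimensional
manifolds without boundary this amounts to being a smooth embedding; unlike that notion it is
formulated without charts. -/
def HasSmoothLocalInverses (f : M → N) : Prop :=
  ∀ x, ∃ r : N → M, ContMDiffAt J I ∞ r (f x) ∧ ∀ᶠ z in 𝓝 (f x), ∀ q, f q = z → r z = q

namespace HasSmoothLocalInverses

variable {f : M → N}

theorem injective (h : HasSmoothLocalInverses I J f) : Function.Injective f := by
  intro x y hxy
  obtain ⟨r, -, hr⟩ := h x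
  rw [← hr.self_of_nhds x rfl, ← hr.self_of_nhds y hxy.symm]

theorem isEmbedding (h : HasSmoothLocalInverses I J f) (hf : Continuous f) :
    IsEmbedding f := by
  refine ⟨isInducing_iff_nhds.2 fun x => le_antisymm (map_le_iff_le_comap.1 hf.continuousAt) ?_,
    h.injective⟩
  obtain ⟨r, hr, hrf⟩ := h x
  intro u hu
  have hrx : r (f x) = x := hrf.self_of_nhds x rfl
  have := hr.continuousAt.preimage_mem_nhds (hrx.symm ▸ hu)
  refine mem_comap.2 ⟨_, inter_mem this hrf, ?_⟩
  rintro q ⟨hq1, hq2⟩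
  have : r (f q) = q := hq2 q rfl
  simpa [this] using hq1

/-- A map into the range of `f` that is smooth as a map to the ambient manifold lifts smoothly
along `f`. -/
theorem contMDiffWithinAt_lift (h : HasSmoothLocalInverses I J f) {g : N' → N} {s : Set N'}
    {y : N'} (hg : ContMDiffWithinAt J' J ∞ g s y) {k : N' → M} (hk : ∀ᶠ z in 𝓝[s] y, f (k z) = g z)
    (hky : f (k y) = g y) : ContMDiffWithinAt J' I ∞ k s y := by
  obtain ⟨r, hr, hrf⟩ := h (k y)
  rw [hky] at hr hrf
  refine (hr.comp_contMDiffWithinAt y hg).congr_of_eventuallyEq ?_ (hrf.self_of_nhds _ hky).symm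
  filter_upwards [hk, hg.continuousWithinAt.eventually hrf] with z hz hz'
  exact (hz' _ hz).symm

theorem contMDiffAt_lift (h : HasSmoothLocalInverses I J f) {g : N' → N}
    {y : N'} (hg : ContMDiffAt J' J ∞ g y) {k : N' → M} (hk : ∀ᶠ z in 𝓝 y, f (k z) = g z) :
    ContMDiffAt J' I ∞ k y := by
  rw [← contMDiffWithinAt_univ] at hg ⊢
  exact h.contMDiffWithinAt_lift hg (by simpa using hk) hk.self_of_nhds

/-- If `r` recovers preimages under `f`, then its tangent map recovers preimages under the tangent
map of `f`. -/
theorem tangentMap [IsManifold I ∞ M] [IsManifold J ∞ N] (h : HasSmoothLocalInverses I J f)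
    (hf : ContMDiff I J ∞ f) :
    HasSmoothLocalInverses I.tangent J.tangent (tangentMap I J f) := by
  intro X
  obtain ⟨r, hr, hrf⟩ := h X.1
  refine ⟨_root_.tangentMap J I r, hr.contMDiffAt_tangentMap, ?_⟩
  have h1 := (tendsto_tangentBundle_proj (_root_.tangentMap I J f X)).eventually
    (hrf.eventually_nhds.and hr.eventually_mdifferentiableAt)
  filter_upwards [h1]
  rintro _ ⟨hZ, hZ'⟩ W rfl
  have h2 : r ∘ f =ᶠ[𝓝 W.1] id := by
    filter_upwards [(hf.continuous.continuousAt (x := W.1)).eventually hZ] with q hq using hq q rfl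
  rw [← tangentMap_comp_at W hZ' (hf.mdifferentiable (by simp) _),
    tangentMap_congr_of_eventuallyEq h2, tangentMap_id, id]

theorem comp_left (h : HasSmoothLocalInverses I J f) {Φ : N ≃ N'}
    (hΦ' : ContMDiff J' J ∞ Φ.symm) : HasSmoothLocalInverses I J' (Φ ∘ f) := by
  intro x
  obtain ⟨r, hr, hrf⟩ := h x
  have e : Φ.symm (Φ (f x)) = f x := Φ.symm_apply_apply _
  refine ⟨r ∘ Φ.symm, ContMDiffAt.comp _ (by simpa using hr) hΦ'.contMDiffAt, ?_⟩
  have := hΦ'.continuous.tendsto (Φ (f x))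
  rw [e] at this
  filter_upwards [this.eventually hrf]
  rintro _ hz q rfl
  exact hz q (by simp)

theorem tangentMap_prodMk [IsManifold I ∞ M] [IsManifold J ∞ N] [IsManifold J' ∞ N']
    {g : M → N'} (h : HasSmoothLocalInverses I (J.prod J') fun x => (f x, g x))
    (hf : ContMDiff I J ∞ f) (hg : ContMDiff I J' ∞ g) :
    HasSmoothLocalInverses I.tangent (J.tangent.prod J'.tangent)
      fun X => (_root_.tangentMap I J f X, _root_.tangentMap I J' g X) := by
  have h1 := (h.tangentMap (hf.prodMk hg)).comp_left
    (Φ := equivTangentBundleProd J N J' N')     contMDiff_equivTangentBundleProd_symm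
  convert h1 using 2 with X
  exact (equivTangentBundleProd_tangentMap_prodMk (hf.mdifferentiable (by simp) _)
    (hg.mdifferentiable (by simp) _)).symm

theorem mfderiv_injective (h : HasSmoothLocalInverses I J f)
    (hf : ContMDiff I J ∞ f) (x : M) : Function.Injective (mfderiv I J f x) := by
  obtain ⟨r, hr, hrf⟩ := h x
  have h2 : r ∘ f =ᶠ[𝓝 x] id := by
    filter_upwards [(hf.continuous.continuousAt (x := x)).eventually hrf] with q hq using hq q rfl
  have h3 := mfderiv_comp x (hr.mdifferentiableAt (by simp)) (hf.mdifferentiable (by simp) _)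
  rw [h2.mfderiv_eq, mfderiv_id] at h3
  intro v w hvw
  have hv := DFunLike.congr_fun h3 v
  have hw := DFunLike.congr_fun h3 w
  have e : ((mfderiv J I r (f x)).comp (mfderiv I J f x)) v =
    ((mfderiv J I r (f x)).comp (mfderiv I J f x)) w := congrArg (mfderiv J I r (f x)) hvw
  exact hv.trans (e.trans hw.symm)

end HasSmoothLocalInverses

end SmoothLocalInverses

/-! ### Local structure of embeddings and submersions -/

section EmbeddingsAndSubmersions

open Filter Topology

variable {E H M E' H' N : Type*}
  [NormedAddCommGroup E] [NormedSpace ℝ E] [TopologicalSpace H]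
  [NormedAddCommGroup E'] [NormedSpace ℝ E'] [TopologicalSpace H']
  {I : ModelWithCorners ℝ E H} {J : ModelWithCorners ℝ E' H'} [I.Boundaryless]
  [TopologicalSpace M] [ChartedSpace H M]
  [TopologicalSpace N] [ChartedSpace H' N]

theorem contMDiffAt_extend_symm_of_mem_maximalAtlas {φ : OpenPartialHomeomorph M H}
    (hφ : φ ∈ IsManifold.maximalAtlas I ∞ M) {y : E} (hy : I.symm y ∈ φ.target) :
    ContMDiffAt 𝓘(ℝ, E) I ∞ (φ.extend I).symm y := by
  have h1 := contMDiffAt_symm_of_mem_maximalAtlas hφ hy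
  have h2 : ContMDiffAt 𝓘(ℝ, E) I ∞ I.symm y :=
    (I.contMDiffOn_symm (n := ∞) y (by simp [I.range_eq_univ])).contMDiffAt
      (by simp [I.range_eq_univ])
  exact h1.comp y h2

omit [I.Boundaryless] in
theorem contMDiffAt_extend_of_mem_maximalAtlas {φ : OpenPartialHomeomorph M H}
    (hφ : φ ∈ IsManifold.maximalAtlas I ∞ M) {x : M} (hx : x ∈ φ.source) :
    ContMDiffAt I 𝓘(ℝ, E) ∞ (φ.extend I) x :=
  (φ.contMDiffOn_extend hφ).contMDiffAt (φ.open_source.mem_nhds hx)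

/-- In charts where `f` is `u ↦ (u, 0)`, the projection `(u, w) ↦ u` recovers nearby preimages;
since `f` is a topological embedding there are no preimages elsewhere. -/
theorem Manifold.IsSmoothEmbedding.hasSmoothLocalInverses {f : M → N}
    (hf : Manifold.IsSmoothEmbedding I J ∞ f) : HasSmoothLocalInverses I J f := by
  intro x
  have h := hf.isImmersion.isImmersionOfComplement_complement x
  let r : N → M := fun z => (h.domChart.extend I).symm (h.equiv.symm (h.codChart.extend J z)).1
  have key : ∀ q ∈ h.domChart.source, h.equiv.symm (h.codChart.extend J (f q)) =
      (h.domChart.extend I q, 0) := by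
    intro q hq
    have hq' : q ∈ (h.domChart.extend I).source := by simpa using hq
    have := h.writtenInCharts ((h.domChart.extend I).map_source hq')
    simp only [Function.comp_apply, (h.domChart.extend I).left_inv hq'] at this
    rw [this, h.equiv.symm_apply_apply]
  refine ⟨r, ?_, ?_⟩
  · have h1 := contMDiffAt_extend_of_mem_maximalAtlas h.codChart_mem_maximalAtlas
      h.mem_codChart_source
    have h2 : ContMDiffAt 𝓘(ℝ, E') 𝓘(ℝ, E) ∞ (fun z => (h.equiv.symm z).1)
        (h.codChart.extend J (f x)) :=
      (contDiff_fst.comp h.equiv.symm.contDiff).contMDiff.contMDiffAt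
    refine ContMDiffAt.comp (f x) ?_ (h2.comp (f x) h1)
    apply contMDiffAt_extend_symm_of_mem_maximalAtlas h.domChart_mem_maximalAtlas
    simp only [key x h.mem_domChart_source]
    simpa using h.domChart.map_source h.mem_domChart_source
  · have := (hf.isEmbedding.isInducing.nhds_eq_comap x) ▸
      h.domChart.open_source.mem_nhds h.mem_domChart_source
    obtain ⟨O, hO, hOs⟩ := mem_comap.1 this
    filter_upwards [hO]
    rintro _ hz q rfl
    have hq : q ∈ h.domChart.source := hOs hz
    simp only [r, key q hq]
    exact (h.domChart.extend I).left_inv (by simpa using hq)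

universe u in
/-- A submersion is locally trivial: near `y₀` the manifold `M` is the product of the base with
a vector space `F`, by means of `y ↦ (α y, v y)` with inverse `Ψ`. -/
theorem Manifold.IsSubmersion.exists_local_trivialization
    {E : Type u} [NormedAddCommGroup E] [NormedSpace ℝ E] [FiniteDimensional ℝ E]
    {I : ModelWithCorners ℝ E H} [I.Boundaryless] {α : M → N}
    (hα : Manifold.IsSubmersion I J ∞ α) (y₀ : M) :
    ∃ (F : Type u) (_ : NormedAddCommGroup F) (_ : NormedSpace ℝ F) (_ : FiniteDimensional ℝ F)
      (v : M → F) (Ψ : N × F → M),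
      ContMDiffAt I 𝓘(ℝ, F) ∞ v y₀ ∧ ContMDiffAt (J.prod 𝓘(ℝ, F)) I ∞ Ψ (α y₀, v y₀) ∧
      (∀ᶠ y in 𝓝 y₀, Ψ (α y, v y) = y) ∧
      ∀ᶠ z in 𝓝 (α y₀, v y₀), α (Ψ z) = z.1 ∧ v (Ψ z) = z.2 := by
  have h := hα.isSubmersionOfComplement_complement y₀
  let φ := h.domChart
  let ψ := h.codChart
  let F := hα.complement
  have : FiniteDimensional ℝ F := by
    have : FiniteDimensional ℝ (E' × F) := h.equiv.toLinearEquiv.finiteDimensional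
    exact FiniteDimensional.of_surjective (LinearMap.snd ℝ E' F) LinearMap.snd_surjective
  let v : M → F := fun y => (h.equiv (φ.extend I y)).2
  let Ψ : N × F → M := fun z => (φ.extend I).symm (h.equiv.symm (ψ.extend J z.1, z.2))
  have key : ∀ y ∈ φ.source, h.equiv (φ.extend I y) = (ψ.extend J (α y), v y) := by
    intro y hy
    have hy' : y ∈ (φ.extend I).source := by simpa using hy
    have := h.writtenInCharts ((φ.extend I).map_source hy')
    simp only [Function.comp_apply] at this
    rw [(φ.extend I).left_inv hy'] at this
    exact Prod.ext this.symm rfl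
  have hψs : ContMDiffAt J 𝓘(ℝ, E') ∞ (ψ.extend J) (α y₀) :=
    contMDiffAt_extend_of_mem_maximalAtlas h.codChart_mem_maximalAtlas h.mem_codChart_source
  -- the coordinate expression of `Ψ` before the chart of the total space is applied
  have hc : ContMDiffAt (J.prod 𝓘(ℝ, F)) 𝓘(ℝ, E) ∞
      (fun z : N × F => h.equiv.symm (ψ.extend J z.1, z.2)) (α y₀, v y₀) := by
    have h1 : ContMDiffAt (J.prod 𝓘(ℝ, F)) 𝓘(ℝ, E') ∞
        (fun z : N × F => ψ.extend J z.1) (α y₀, v y₀) :=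
      ContMDiffAt.comp (α y₀, v y₀) (g := ψ.extend J) (f := Prod.fst) hψs contMDiffAt_fst
    exact ContMDiffAt.comp (α y₀, v y₀) (h.equiv.symm.contDiff.contMDiff.contMDiffAt)
      (h1.prodMk_space contMDiffAt_snd)
  have hc0 : h.equiv.symm (ψ.extend J (α y₀), v y₀) = φ.extend I y₀ := by
    rw [← key y₀ h.mem_domChart_source, h.equiv.symm_apply_apply]
  have ht : (φ.extend I).target ∈ 𝓝 (φ.extend I y₀) := by
    apply IsOpen.mem_nhds
    · rw [φ.extend_target, I.range_eq_univ, inter_univ]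
      exact φ.open_target.preimage I.continuous_symm
    · exact (φ.extend I).map_source (by simpa using h.mem_domChart_source)
  refine ⟨F, inferInstance, inferInstance, this, v, Ψ, ?_, ?_, ?_, ?_⟩
  · exact ContMDiffAt.comp (g := fun e => (h.equiv e).2) (f := φ.extend I) y₀
      ((contDiff_snd.comp h.equiv.contDiff).contMDiff.contMDiffAt)
      (contMDiffAt_extend_of_mem_maximalAtlas h.domChart_mem_maximalAtlas h.mem_domChart_source)
  · refine ContMDiffAt.comp (α y₀, v y₀) ?_ hc
    apply contMDiffAt_extend_symm_of_mem_maximalAtlas h.domChart_mem_maximalAtlas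
    simp only [hc0]
    simpa using φ.map_source h.mem_domChart_source
  · filter_upwards [φ.open_source.mem_nhds h.mem_domChart_source] with y hy
    simp only [Ψ]
    rw [← key y hy, h.equiv.symm_apply_apply]
    exact (φ.extend I).left_inv (by simpa using hy)
  · have h1 := hc.continuousAt.tendsto
    simp only [hc0] at h1
    have h2 : ∀ᶠ z : N × F in 𝓝 (α y₀, v y₀), z.1 ∈ ψ.source :=
      continuousAt_fst.eventually (ψ.open_source.mem_nhds h.mem_codChart_source)
    filter_upwards [h1.eventually ht, h2] with z hz hz2
    have hzs : Ψ z ∈ φ.source := by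
      rw [← φ.extend_source (I := I)]
      exact (φ.extend I).map_target hz
    have h3 := key _ hzs
    simp only [Ψ, (φ.extend I).right_inv hz, h.equiv.apply_symm_apply] at h3
    have h4 := Prod.ext_iff.1 h3
    refine ⟨?_, h4.2.symm⟩
    exact ((ψ.extend J).injOn (by rwa [ψ.extend_source])
      (by rw [ψ.extend_source]; exact h.source_subset_preimage_source hzs) h4.1).symm

end EmbeddingsAndSubmersions

/-! ### The inverse function theorem -/

section InverseFunction

open Filter Topology

variable {E H M E' H' N : Type*}
  [NormedAddCommGroup E] [NormedSpace ℝ E] [FiniteDimensional ℝ E] [TopologicalSpace H]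
  [NormedAddCommGroup E'] [NormedSpace ℝ E'] [FiniteDimensional ℝ E'] [TopologicalSpace H']
  {I : ModelWithCorners ℝ E H} {J : ModelWithCorners ℝ E' H'} [I.Boundaryless]
  [TopologicalSpace M] [ChartedSpace H M] [IsManifold I ∞ M]
  [TopologicalSpace N] [ChartedSpace H' N]

/-- The inverse function theorem on manifolds without boundary. -/
theorem ContMDiffAt.exists_local_right_inverse {f : M → N} {x : M} (hf : ContMDiffAt I J ∞ f x)
    (hbij : Function.Bijective (mfderiv I J f x)) :
    ∃ g : N → M, ContMDiffAt J I ∞ g (f x) ∧ g (f x) = x ∧ ∀ᶠ z in 𝓝 (f x), f (g z) = z := by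
  have := FiniteDimensional.complete ℝ E
  have := FiniteDimensional.complete ℝ E'
  let fh := writtenInExtChartAt I J x f
  let D : E →L[ℝ] E' := mfderiv I J f x
  let A : E ≃L[ℝ] E' := (LinearEquiv.ofBijective (D : E →ₗ[ℝ] E') hbij).toContinuousLinearEquiv
  have hfh : ContDiffAt ℝ ∞ fh (extChartAt I x x) := by
    have := (contMDiffAt_iff.1 hf).2
    rwa [I.range_eq_univ, contDiffWithinAt_univ] at this
  have hD : HasFDerivAt fh (A : E →L[ℝ] E') (extChartAt I x x) := by
    have h : HasFDerivWithinAt fh D (range I) (extChartAt I x x) :=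
      (hf.mdifferentiableAt (by simp)).hasMFDerivAt.2
    rwa [I.range_eq_univ, hasFDerivWithinAt_univ] at h
  let k := hfh.localInverse hD (by simp)
  have hk : ContDiffAt ℝ ∞ k (fh (extChartAt I x x)) := hfh.to_localInverse hD (by simp)
  have hkx : k (fh (extChartAt I x x)) = extChartAt I x x :=
    hfh.localInverse_apply_image hD (by simp)
  have hkr : ∀ᶠ z in 𝓝 (fh (extChartAt I x x)), fh (k z) = z :=
    (hfh.hasStrictFDerivAt' hD (by simp)).eventually_right_inverse
  have hfx : fh (extChartAt I x x) = extChartAt J (f x) (f x) := by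
    simp [fh, writtenInExtChartAt]
  rw [hfx] at hk hkx hkr
  let g : N → M := fun z => (extChartAt I x).symm (k (extChartAt J (f x) z))
  have hψ : ContMDiffAt J 𝓘(ℝ, E') ∞ (extChartAt J (f x)) (f x) := contMDiffAt_extChartAt
  have hg1 : ContMDiffAt J 𝓘(ℝ, E) ∞ (fun z => k (extChartAt J (f x) z)) (f x) :=
    ContMDiffAt.comp (f x) (g := k) hk.contMDiffAt hψ
  have hgx : g (f x) = x := by simp only [g, hkx, extChartAt_to_inv]
  have hg : ContMDiffAt J I ∞ g (f x) := by
    refine ContMDiffAt.comp (f x) (g := (extChartAt I x).symm) ?_ hg1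
    rw [hkx]
    exact (contMDiffOn_extChartAt_symm x).contMDiffAt (extChartAt_target_mem_nhds x)
  refine ⟨g, hg, hgx, ?_⟩
  have hfg : Tendsto (fun z => f (g z)) (𝓝 (f x)) (𝓝 (f x)) := by
    have h2 := hg.continuousAt.tendsto
    rw [hgx] at h2
    exact hf.continuousAt.tendsto.comp h2
  have ht := hg1.continuousAt.tendsto
  rw [hkx] at ht
  filter_upwards [hψ.continuousAt.eventually hkr, ht.eventually (extChartAt_target_mem_nhds x),
    extChartAt_source_mem_nhds (I := J) (f x), hfg (extChartAt_source_mem_nhds (I := J) (f x))]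
    with z hz1 hz2 hz3 hz4
  exact (extChartAt J (f x)).injOn hz4 hz3 hz1

end InverseFunction

/-! ### Charts of the tangent bundle; tangent maps of immersions and submersions -/

section TangentChart

open Filter Topology

variable {E H M E' H' N : Type*}
  [NormedAddCommGroup E] [NormedSpace ℝ E] [TopologicalSpace H]
  [NormedAddCommGroup E'] [NormedSpace ℝ E'] [TopologicalSpace H']
  {I : ModelWithCorners ℝ E H} {J : ModelWithCorners ℝ E' H'}
  [TopologicalSpace M] [ChartedSpace H M] [IsManifold I ∞ M]
  [TopologicalSpace N] [ChartedSpace H' N] [IsManifold J ∞ N]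

theorem ContMDiffOn.contMDiffOn_tangentMap {f : M → N} {s : Set M} (hs : IsOpen s)
    (hf : ContMDiffOn I J ∞ f s) :
    ContMDiffOn I.tangent J.tangent ∞ (tangentMap I J f)
      ((fun X : TangentBundle I M => X.1) ⁻¹' s) :=
  fun _ hX => (hf.contMDiffAt (hs.mem_nhds hX)).contMDiffAt_tangentMap.contMDiffWithinAt

/-- The chart of the tangent bundle induced by an arbitrary chart `φ` of the smooth structure:
it is `X ↦ (φ x, dφ X)` for `X` a tangent vector at `x`. -/
noncomputable def tangentChart (φ : OpenPartialHomeomorph M H)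
    (hφ : φ ∈ IsManifold.maximalAtlas I ∞ M) :
    OpenPartialHomeomorph (TangentBundle I M) (ModelProd H E) where
  toFun X := tangentBundleModelSpaceHomeomorph I (tangentMap I I φ X)
  invFun z := tangentMap I I φ.symm ((tangentBundleModelSpaceHomeomorph I).symm z)
  source := (fun X : TangentBundle I M => X.1) ⁻¹' φ.source
  target := Prod.fst ⁻¹' φ.target
  map_source' X hX := φ.map_source hX
  map_target' z hz := φ.map_target hz
  left_inv' X hX := by
    rw [Homeomorph.symm_apply_apply, ← tangentMap_comp_at X
      ((contMDiffAt_symm_of_mem_maximalAtlas hφ (φ.map_source hX)).mdifferentiableAt (by simp))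
      ((contMDiffAt_of_mem_maximalAtlas hφ hX).mdifferentiableAt (by simp)),
      tangentMap_congr_of_eventuallyEq (f := φ.symm ∘ φ) (g := id)
        (φ.eventually_left_inverse hX), tangentMap_id, id]
  right_inv' z hz := by
    rw [← tangentMap_comp_at ((tangentBundleModelSpaceHomeomorph I).symm z)
      ((contMDiffAt_of_mem_maximalAtlas hφ (φ.map_target hz)).mdifferentiableAt (by simp))
      ((contMDiffAt_symm_of_mem_maximalAtlas hφ hz).mdifferentiableAt (by simp)),
      tangentMap_congr_of_eventuallyEq (f := φ ∘ φ.symm) (g := id)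
        (X := (tangentBundleModelSpaceHomeomorph I).symm z)
        (φ.eventually_right_inverse (x := z.1) hz), tangentMap_id,
      id, Homeomorph.apply_symm_apply]
  open_source := φ.open_source.preimage
    (FiberBundle.continuous_proj E (TangentSpace I : M → Type _))
  open_target := φ.open_target.preimage continuous_fst
  continuousOn_toFun := (tangentBundleModelSpaceHomeomorph I).continuous.comp_continuousOn
    ((contMDiffOn_of_mem_maximalAtlas hφ).contMDiffOn_tangentMap φ.open_source).continuousOn
  continuousOn_invFun :=
    ((contMDiffOn_symm_of_mem_maximalAtlas hφ).contMDiffOn_tangentMap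
      φ.open_target).continuousOn.comp
      (tangentBundleModelSpaceHomeomorph I).symm.continuous.continuousOn fun _ hz => hz

theorem tangentChart_mem_maximalAtlas {φ : OpenPartialHomeomorph M H}
    (hφ : φ ∈ IsManifold.maximalAtlas I ∞ M) :
    tangentChart φ hφ ∈ IsManifold.maximalAtlas I.tangent ∞ (TangentBundle I M) := by
  apply OpenPartialHomeomorph.mem_maximalAtlas_of_contMDiffOn
  · exact contMDiff_tangentBundleModelSpaceHomeomorph.comp_contMDiffOn
      ((contMDiffOn_of_mem_maximalAtlas hφ).contMDiffOn_tangentMap φ.open_source)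
  · exact ((contMDiffOn_symm_of_mem_maximalAtlas hφ).contMDiffOn_tangentMap φ.open_target).comp
      contMDiff_tangentBundleModelSpaceHomeomorph_symm.contMDiffOn fun _ hz => hz

/-- If `f` is the linear map `L` in the charts `φ` and `ψ`, then its tangent map is `L × L` in the
induced charts of the tangent bundles. -/
theorem tangentMap_eqOn_tangentChart [I.Boundaryless] [J.Boundaryless] {f : M → N}
    (hf : ContMDiff I J ∞ f) {φ : OpenPartialHomeomorph M H} {ψ : OpenPartialHomeomorph N H'}
    (hφ : φ ∈ IsManifold.maximalAtlas I ∞ M) (hψ : ψ ∈ IsManifold.maximalAtlas J ∞ N)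
    (hs : φ.source ⊆ f ⁻¹' ψ.source) (L : E →L[ℝ] E')
    (hL : EqOn (ψ.extend J ∘ f ∘ (φ.extend I).symm) L (φ.extend I).target) :
    EqOn ((tangentChart ψ hψ).extend J.tangent ∘ tangentMap I J f ∘
      ((tangentChart φ hφ).extend I.tangent).symm) (L.prodMap L)
      ((tangentChart φ hφ).extend I.tangent).target := by
  rintro ⟨e, w⟩ hew
  have he : I.symm e ∈ φ.target := by
    rw [OpenPartialHomeomorph.extend_target] at hew
    exact hew.1
  have he' : e ∈ (φ.extend I).target := by
    rw [OpenPartialHomeomorph.extend_target]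
    exact ⟨he, by simp [I.range_eq_univ]⟩
  have hIe : I (I.symm e) = e := I.right_inv (by simp [I.range_eq_univ])
  have d1 : MDifferentiableAt I I φ.symm (I.symm e) :=
    (contMDiffAt_symm_of_mem_maximalAtlas hφ he).mdifferentiableAt (by simp)
  have d2 : MDifferentiableAt I J f (φ.symm (I.symm e)) := hf.mdifferentiable (by simp) _
  have d3 : MDifferentiableAt J J ψ (f (φ.symm (I.symm e))) :=
    (contMDiffAt_of_mem_maximalAtlas hψ (hs (φ.map_target he))).mdifferentiableAt (by simp)
  have hd : HasMFDerivAt I J (ψ ∘ f ∘ φ.symm) (I.symm e) L := by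
    refine ⟨(d3.comp (I.symm e) (d2.comp (I.symm e) d1)).continuousAt, ?_⟩
    have h1 : HasFDerivAt (writtenInExtChartAt I J (I.symm e) (ψ ∘ f ∘ φ.symm)) L e := by
      refine (L.hasFDerivAt.congr_of_eventuallyEq ?_)
      have : (φ.extend I).target ∈ 𝓝 e := by
        refine IsOpen.mem_nhds ?_ he'
        rw [φ.extend_target, I.range_eq_univ, inter_univ]
        exact φ.open_target.preimage I.continuous_symm
      filter_upwards [this] with y hy
      exact hL hy
    have h2 : HasFDerivWithinAt (writtenInExtChartAt I J (I.symm e) (ψ ∘ f ∘ φ.symm)) L (range I)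
        (I (I.symm e)) := hIe.symm ▸ h1.hasFDerivWithinAt
    exact h2
  have hc := (d3.hasMFDerivAt.comp (I.symm e) (d2.hasMFDerivAt.comp (I.symm e) d1.hasMFDerivAt))
  have hu := hasMFDerivAt_unique hc hd
  exact Prod.ext (hL he') (DFunLike.congr_fun hu w)

/-- The tangent map of a submersion is a submersion. -/
theorem Manifold.IsSubmersion.tangentMap [I.Boundaryless] [J.Boundaryless] {f : M → N}
    (hf : Manifold.IsSubmersion I J ∞ f) :
    Manifold.IsSubmersion I.tangent J.tangent ∞ (tangentMap I J f) := by
  suffices Manifold.IsSubmersionOfComplement (hf.complement × hf.complement) I.tangent J.tangent ∞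
      (_root_.tangentMap I J f) from this.isSubmersion
  intro X
  have h := hf.isSubmersionOfComplement_complement X.1
  refine Manifold.IsSubmersionAtOfComplement.mk_of_charts
    ((h.equiv.prodCongr h.equiv).trans
      (ContinuousLinearEquiv.prodProdProdComm ℝ E' hf.complement E' hf.complement))
    (tangentChart h.domChart h.domChart_mem_maximalAtlas)
    (tangentChart h.codChart h.codChart_mem_maximalAtlas)
    h.mem_domChart_source h.mem_codChart_source
    (tangentChart_mem_maximalAtlas _) (tangentChart_mem_maximalAtlas _)
    (fun Y hY => h.source_subset_preimage_source hY) ?_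
  exact tangentMap_eqOn_tangentChart hf.contMDiff h.domChart_mem_maximalAtlas
    h.codChart_mem_maximalAtlas h.source_subset_preimage_source
    ((ContinuousLinearMap.fst ℝ E' hf.complement).comp (h.equiv : E →L[ℝ] E' × hf.complement))
    h.writtenInCharts

/-- The tangent map of an immersion is an immersion. -/
theorem Manifold.IsImmersion.tangentMap [I.Boundaryless] [J.Boundaryless] {f : M → N}
    (hf : Manifold.IsImmersion I J ∞ f) :
    Manifold.IsImmersion I.tangent J.tangent ∞ (tangentMap I J f) := by
  suffices Manifold.IsImmersionOfComplement (hf.complement × hf.complement) I.tangent J.tangent ∞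
      (_root_.tangentMap I J f) from this.isImmersion
  intro X
  have h := hf.isImmersionOfComplement_complement X.1
  refine Manifold.IsImmersionAtOfComplement.mk_of_charts
    ((ContinuousLinearEquiv.prodProdProdComm ℝ E E hf.complement hf.complement).trans
      (h.equiv.prodCongr h.equiv))
    (tangentChart h.domChart h.domChart_mem_maximalAtlas)
    (tangentChart h.codChart h.codChart_mem_maximalAtlas)
    h.mem_domChart_source h.mem_codChart_source
    (tangentChart_mem_maximalAtlas _) (tangentChart_mem_maximalAtlas _)
    (fun Y hY => h.source_subset_preimage_source hY) ?_
  exact tangentMap_eqOn_tangentChart hf.contMDiff h.domChart_mem_maximalAtlas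
    h.codChart_mem_maximalAtlas h.source_subset_preimage_source
    ((h.equiv : E × hf.complement →L[ℝ] E').comp (ContinuousLinearMap.inl ℝ E hf.complement))
    h.writtenInCharts

end TangentChart

/-! ### Composition of an immersion with a diffeomorphism -/

section CompDiffeo

open Filter Topology

variable {E H M E₁ H₁ N₁ E₂ H₂ N₂ : Type*}
  [NormedAddCommGroup E] [NormedSpace ℝ E] [TopologicalSpace H]
  [NormedAddCommGroup E₁] [NormedSpace ℝ E₁] [TopologicalSpace H₁]
  [NormedAddCommGroup E₂] [NormedSpace ℝ E₂] [TopologicalSpace H₂]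
  {I : ModelWithCorners ℝ E H} {J₁ : ModelWithCorners ℝ E₁ H₁} {J₂ : ModelWithCorners ℝ E₂ H₂}
  [J₁.Boundaryless] [J₂.Boundaryless]
  [TopologicalSpace M] [ChartedSpace H M]
  [TopologicalSpace N₁] [ChartedSpace H₁ N₁]
  [TopologicalSpace N₂] [ChartedSpace H₂ N₂] [IsManifold J₂ ∞ N₂]

/-- The composition of an immersion with a diffeomorphism is an immersion. The model spaces of the
two target manifolds may differ, as long as the model vector spaces are isomorphic. -/
theorem Manifold.IsImmersion.equiv_comp {f : M → N₁} (hf : Manifold.IsImmersion I J₁ ∞ f)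
    (Φ : N₁ ≃ N₂) (hΦ : ContMDiff J₁ J₂ ∞ Φ) (hΦ' : ContMDiff J₂ J₁ ∞ Φ.symm) (A : E₁ ≃L[ℝ] E₂) :
    Manifold.IsImmersion I J₂ ∞ (Φ ∘ f) := by
  suffices Manifold.IsImmersionOfComplement hf.complement I J₂ ∞ (Φ ∘ f) from this.isImmersion
  intro x
  have h := hf.isImmersionOfComplement_complement x
  let Φh : N₁ ≃ₜ N₂ := ⟨Φ, hΦ.continuous, hΦ'.continuous⟩
  let θ : H₁ ≃ₜ H₂ := (J₁.toHomeomorph.trans A.toHomeomorph).trans J₂.toHomeomorph.symm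
  let ψ : OpenPartialHomeomorph N₂ H₂ :=
    (Φh.symm.toOpenPartialHomeomorph.trans h.codChart).trans θ.toOpenPartialHomeomorph
  have hθ : ContMDiff J₁ J₂ ∞ θ := by
    have h1 : ContMDiff 𝓘(ℝ, E₂) J₂ ∞ J₂.symm := by
      rw [← contMDiffOn_univ, ← J₂.range_eq_univ]; exact J₂.contMDiffOn_symm
    exact h1.comp (A.contDiff.contMDiff.comp J₁.contMDiff)
  have hθ' : ContMDiff J₂ J₁ ∞ θ.symm := by
    have h1 : ContMDiff 𝓘(ℝ, E₁) J₁ ∞ J₁.symm := by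
      rw [← contMDiffOn_univ, ← J₁.range_eq_univ]; exact J₁.contMDiffOn_symm
    exact h1.comp (A.symm.contDiff.contMDiff.comp J₂.contMDiff)
  have hs : ψ.source = Φ.symm ⁻¹' h.codChart.source := by
    ext z; simp [ψ, Φh]
  have ht : ψ.target = θ.symm ⁻¹' h.codChart.target := by
    ext z; simp [ψ]
  refine Manifold.IsImmersionAtOfComplement.mk_of_charts (h.equiv.trans A) h.domChart ψ
    h.mem_domChart_source ?_ h.domChart_mem_maximalAtlas ?_ ?_ ?_
  · rw [hs]; simpa using h.mem_codChart_source
  · apply OpenPartialHomeomorph.mem_maximalAtlas_of_contMDiffOn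
    · rw [hs]
      exact hθ.comp_contMDiffOn ((contMDiffOn_of_mem_maximalAtlas h.codChart_mem_maximalAtlas).comp
        hΦ'.contMDiffOn subset_rfl)
    · rw [ht]
      exact hΦ.comp_contMDiffOn ((contMDiffOn_symm_of_mem_maximalAtlas
        h.codChart_mem_maximalAtlas).comp hθ'.contMDiffOn subset_rfl)
  · intro z hz
    rw [hs]
    simpa using h.source_subset_preimage_source hz
  · intro e he
    have := h.writtenInCharts he
    simp only [Function.comp_apply] at this
    simp only [Function.comp_apply, ContinuousLinearEquiv.trans_apply, ← this]
    simp [ψ, Φh, θ, J₂.right_inv, J₂.range_eq_univ]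

end CompDiffeo

/-! ### Topology of the tangent bundle -/

section Topology

open Filter Topology

variable {E H M : Type*}
  [NormedAddCommGroup E] [NormedSpace ℝ E] [TopologicalSpace H]
  {I : ModelWithCorners ℝ E H}
  [TopologicalSpace M] [ChartedSpace H M] [IsManifold I ∞ M]

theorem TangentBundle.t2Space [T2Space M] : T2Space (TangentBundle I M) := by
  refine ⟨fun X Y hXY => ?_⟩
  have hπ := FiberBundle.continuous_proj E (TangentSpace I : M → Type _)
  -- vectors at one point are separated in a trivialization, all others by their base points
  by_cases h : X.1 = Y.1
  · let t := trivializationAt E (TangentSpace I : M → Type _) X.1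
    have hX : X ∈ t.source := t.mem_source.2 (FiberBundle.mem_baseSet_trivializationAt' X.1)
    have hY : Y ∈ t.source :=
      t.mem_source.2 (h ▸ FiberBundle.mem_baseSet_trivializationAt' X.1)
    have hne : (t X).2 ≠ (t Y).2 := fun e => hXY <| t.injOn hX hY <| Prod.ext
      ((t.coe_fst hX).trans (h.trans (t.coe_fst hY).symm)) e
    obtain ⟨u, v, hu, hv, hXu, hYv, huv⟩ := t2_separation hne
    have hc : ContinuousOn (fun Z => (t Z).2) t.source :=
      continuous_snd.comp_continuousOn t.continuousOn
    exact ⟨_, _, hc.isOpen_inter_preimage t.open_source hu,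
      hc.isOpen_inter_preimage t.open_source hv, ⟨hX, hXu⟩, ⟨hY, hYv⟩,
      (huv.preimage _).mono inter_subset_right inter_subset_right⟩
  · obtain ⟨u, v, hu, hv, hXu, hYv, huv⟩ := t2_separation h
    exact ⟨_, _, hu.preimage hπ, hv.preimage hπ, hXu, hYv, huv.preimage _⟩

theorem TangentBundle.secondCountableTopology [FiniteDimensional ℝ E]
    [SecondCountableTopology M] : SecondCountableTopology (TangentBundle I M) := by
  have : SecondCountableTopology E := by
    have : ProperSpace E := FiniteDimensional.proper ℝ E
    infer_instance
  have : SecondCountableTopology H := I.secondCountableTopology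
  obtain ⟨s, hsc, hs⟩ := TopologicalSpace.countable_cover_nhds
    fun x : M => chart_source_mem_nhds H x
  have : SecondCountableTopology (ModelProd H E) :=
    inferInstanceAs (SecondCountableTopology (H × E))
  refine ChartedSpace.secondCountable_of_countable_cover (ModelProd H E)
    (s := (fun x : M => (⟨x, 0⟩ : TangentBundle I M)) '' s) ?_ (hsc.image _)
  rw [biUnion_image, eq_univ_iff_forall]
  intro X
  have : X.1 ∈ ⋃ x ∈ s, (chartAt H x).source := hs ▸ mem_univ _
  simp only [mem_iUnion] at this ⊢
  obtain ⟨x, hx, hX⟩ := this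
  exact ⟨x, hx, (TangentBundle.mem_chart_source_iff _ _).2 hX⟩

end Topology

/-! ### Smooth fibre products -/

section FibreProducts

open Filter Topology

variable {EG HG G EM HM M EP HP P : Type*}
  [NormedAddCommGroup EG] [NormedSpace ℝ EG] [TopologicalSpace HG]
  [NormedAddCommGroup EM] [NormedSpace ℝ EM] [TopologicalSpace HM]
  [NormedAddCommGroup EP] [NormedSpace ℝ EP] [TopologicalSpace HP]
  {IG : ModelWithCorners ℝ EG HG} {IM : ModelWithCorners ℝ EM HM} {IP : ModelWithCorners ℝ EP HP}
  [TopologicalSpace G] [ChartedSpace HG G]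
  [TopologicalSpace M] [ChartedSpace HM M]
  [TopologicalSpace P] [ChartedSpace HP P]

variable (IG IP) in
/-- The manifold `P` with the maps `p, q : P → G` is the fibre product
`{(x, y) ∈ G × G | a x = α y}`, embedded as a submanifold of `G × G` by `(p, q)`. -/
structure IsSmoothFibreProduct (a α : G → M) (p q : P → G) : Prop where
  contMDiff_left : ContMDiff IP IG ∞ p
  contMDiff_right : ContMDiff IP IG ∞ q
  hasSmoothLocalInverses : HasSmoothLocalInverses IP (IG.prod IG) fun z => (p z, q z)
  eq_iff : ∀ x y, a x = α y ↔ ∃ z, p z = x ∧ q z = y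

/-- Local existence of lifts: a map that is smooth at `y` and takes values in the range of `f` near
`y` lifts along `f` to a map smooth at `y`. -/
theorem HasSmoothLocalInverses.exists_contMDiffAt_lift {f : G → M}
    (h : HasSmoothLocalInverses IG IM f) {g : P → M} {y : P} (hg : ContMDiffAt IP IM ∞ g y)
    (hr : ∀ᶠ z in 𝓝 y, g z ∈ range f) :
    ∃ k : P → G, ContMDiffAt IP IG ∞ k y ∧ ∀ᶠ z in 𝓝 y, f (k z) = g z := by
  have : Nonempty G := ⟨hr.self_of_nhds.choose⟩
  have hk : ∀ᶠ z in 𝓝 y, f (Function.invFun f (g z)) = g z :=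
    hr.mono fun z hz => Function.invFun_eq hz
  exact ⟨fun z => Function.invFun f (g z), h.contMDiffAt_lift hg hk, hk⟩

/-- Tangent vectors of the base lift along a submersion, to any prescribed point over their base
point. -/
theorem Manifold.IsSubmersion.exists_tangentMap_eq [FiniteDimensional ℝ EG] [IG.Boundaryless]
    {α : G → M} (hα : Manifold.IsSubmersion IG IM ∞ α) (y : G) (W : TangentBundle IM M)
    (hW : W.1 = α y) : ∃ Y : TangentBundle IG G, Y.1 = y ∧ _root_.tangentMap IG IM α Y = W := by
  obtain ⟨F, _, _, _, v, Ψ, hv, hΨ, hl, hr⟩ := hα.exists_local_trivialization y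
  let Z : TangentBundle (IM.prod 𝓘(ℝ, F)) (M × F) :=
    (equivTangentBundleProd IM M 𝓘(ℝ, F) F).symm (W, ⟨v y, 0⟩)
  have hZ : Z.1 = (α y, v y) := Prod.ext hW rfl
  rw [← hZ] at hΨ hr
  refine ⟨_root_.tangentMap (IM.prod 𝓘(ℝ, F)) IG Ψ Z, ?_, ?_⟩
  · change Ψ Z.1 = y
    rw [hZ]
    exact hl.self_of_nhds
  · rw [← tangentMap_comp_at Z (hα.contMDiff.mdifferentiable (by simp) _)
      (hΨ.mdifferentiableAt (by simp)), tangentMap_congr_of_eventuallyEq (f := α ∘ Ψ)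
      (g := Prod.fst) (hr.mono fun z hz => hz.1), tangentMap_prodFst]
    rfl

namespace IsSmoothFibreProduct

variable {a α : G → M} {p q : P → G}

omit [TopologicalSpace M] in
theorem ext (h : IsSmoothFibreProduct IG IP a α p q) {z w : P} (hp : p z = p w) (hq : q z = q w) :
    z = w :=
  h.hasSmoothLocalInverses.injective (Prod.ext hp hq)

omit [TopologicalSpace M] in
theorem comp_eq (h : IsSmoothFibreProduct IG IP a α p q) (z : P) : a (p z) = α (q z) :=
  (h.eq_iff _ _).2 ⟨z, rfl, rfl⟩

omit [TopologicalSpace M] in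
/-- If `(p₁, p₂)` presents `P` as the fibre product of `β` and `α`, and `(p₁, m)` presents `P` as
the fibre product of `α` with itself, then the partial maps `l_g : p₂ z ↦ m z` on `{p₁ z = g}` are
diffeomorphisms between fibres of `α`. -/
theorem exists_restrictsToDiffeo {β : G → M} {p₁ p₂ m : P → G}
    (h : IsSmoothFibreProduct IG IP β α p₁ p₂) (h' : IsSmoothFibreProduct IG IP α α p₁ m) (g : G) :
    ∃ l : G → G, (∀ x k, MulRel p₁ p₂ m g x k → l x = k) ∧
      RestrictsToDiffeo IG l (α ⁻¹' {β g}) (α ⁻¹' {α g}) := by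
  have hs : ∀ y ∈ α ⁻¹' {β g}, ∃ z, p₁ z = g ∧ p₂ z = y := fun y hy => (h.eq_iff g y).1 hy.symm
  have hs' : ∀ y ∈ α ⁻¹' {α g}, ∃ z, p₁ z = g ∧ m z = y := fun y hy => (h'.eq_iff g y).1 hy.symm
  have hne : Nonempty P := ⟨(hs' g rfl).choose⟩
  choose! s hs1 hs2 using hs
  choose! t ht1 ht2 using hs'
  have hsm : ContMDiffOn IG IP ∞ s (α ⁻¹' {β g}) := fun y hy =>
    h.hasSmoothLocalInverses.contMDiffWithinAt_lift (g := fun y => (g, y))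
      (contMDiffWithinAt_const.prodMk contMDiffWithinAt_id)
      (eventually_mem_nhdsWithin.mono fun z hz => Prod.ext (hs1 z hz) (hs2 z hz))
      (Prod.ext (hs1 y hy) (hs2 y hy))
  have htm : ContMDiffOn IG IP ∞ t (α ⁻¹' {α g}) := fun y hy =>
    h'.hasSmoothLocalInverses.contMDiffWithinAt_lift (g := fun y => (g, y))
      (contMDiffWithinAt_const.prodMk contMDiffWithinAt_id)
      (eventually_mem_nhdsWithin.mono fun z hz => Prod.ext (ht1 z hz) (ht2 z hz))
      (Prod.ext (ht1 y hy) (ht2 y hy))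
  have hsA : MapsTo (fun y => m (s y)) (α ⁻¹' {β g}) (α ⁻¹' {α g}) := fun y hy => by
    change α (m (s y)) = α g
    rw [← h'.comp_eq, hs1 y hy]
  have htA : MapsTo (fun y => p₂ (t y)) (α ⁻¹' {α g}) (α ⁻¹' {β g}) := fun y hy => by
    change α (p₂ (t y)) = β g
    rw [← h.comp_eq, ht1 y hy]
  refine ⟨fun y => m (s y), ?_, hsA, h'.contMDiff_right.comp_contMDiffOn hsm,
    fun y => p₂ (t y), htA, ⟨fun y hy => ?_, fun y hy => ?_⟩,
    h.contMDiff_right.comp_contMDiffOn htm⟩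
  · rintro x k ⟨z, rfl, rfl, rfl⟩
    have hz : p₂ z ∈ α ⁻¹' {β (p₁ z)} := (h.comp_eq z).symm
    exact congrArg m (h.ext (hs1 _ hz) (hs2 _ hz))
  · have : t (m (s y)) = s y := h'.ext ((ht1 _ (hsA hy)).trans (hs1 y hy).symm) (ht2 _ (hsA hy))
    simp only [this, hs2 y hy]
  · have : s (p₂ (t y)) = t y := h.ext ((hs1 _ (htA hy)).trans (ht1 y hy).symm) (hs2 _ (htA hy))
    simp only [this, ht2 y hy]

variable [FiniteDimensional ℝ EG] [IG.Boundaryless]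

/-- Every solution `(X, Y)` of the linearised equation `Ta X = Tα Y` comes from a tangent vector of
the fibre product. The local map `(x, y) ↦ (x, Ψ (a x, v y))` retracts `G × G` onto
the fibre product, where `Ψ` inverts a local trivialization `(α, v)` of the submersion `α`. -/
theorem exists_tangent_lift (h : IsSmoothFibreProduct IG IP a α p q)
    (ha : ContMDiff IG IM ∞ a) (hα : Manifold.IsSubmersion IG IM ∞ α) {X Y : TangentBundle IG G}
    (hXY : tangentMap IG IM a X = tangentMap IG IM α Y) :
    ∃ V : TangentBundle IP P, tangentMap IP IG p V = X ∧ tangentMap IP IG q V = Y := by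
  obtain ⟨F, _, _, _, v, Ψ, hv, hΨ, hl, hr⟩ := hα.exists_local_trivialization Y.1
  have hαs := hα.contMDiff
  have hb : a X.1 = α Y.1 := congrArg (fun Z => Z.1) hXY
  let Z : TangentBundle (IG.prod IG) (G × G) := (equivTangentBundleProd IG G IG G).symm (X, Y)
  have hZ1 : tangentMap (IG.prod IG) IG Prod.fst Z = X := by
    rw [tangentMap_prodFst]; rfl
  have hZ2 : tangentMap (IG.prod IG) IG Prod.snd Z = Y := by
    rw [tangentMap_prodSnd]; rfl
  let c : G × G → M × F := fun z => (a z.1, v z.2)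
  have hc0 : c Z.1 = (α Y.1, v Y.1) := Prod.ext hb rfl
  have hc1 : ContMDiffAt (IG.prod IG) IM ∞ (fun z : G × G => a z.1) Z.1 :=
    (ha.comp contMDiff_fst).contMDiffAt
  have hc2 : ContMDiffAt (IG.prod IG) 𝓘(ℝ, F) ∞ (fun z : G × G => v z.2) Z.1 :=
    ContMDiffAt.comp (g := v) (f := Prod.snd) Z.1 hv contMDiffAt_snd
  have hc : ContMDiffAt (IG.prod IG) (IM.prod 𝓘(ℝ, F)) ∞ c Z.1 := hc1.prodMk hc2
  let d : G × G → G := fun z => Ψ (c z)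
  have hd : ContMDiffAt (IG.prod IG) IG ∞ d Z.1 :=
    ContMDiffAt.comp (g := Ψ) (f := c) Z.1 (hc0 ▸ hΨ) hc
  have hdZ : tangentMap (IG.prod IG) IG d Z = Y := by
    have e1 : tangentMap (IG.prod IG) IG d Z =
        tangentMap (IM.prod 𝓘(ℝ, F)) IG Ψ (tangentMap (IG.prod IG) (IM.prod 𝓘(ℝ, F)) c Z) :=
      tangentMap_comp_at (g := Ψ) (f := c) Z ((hc0 ▸ hΨ).mdifferentiableAt (by simp))
        (hc.mdifferentiableAt (by simp))
    have e2 : tangentMap (IG.prod IG) (IM.prod 𝓘(ℝ, F)) c Z =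
        tangentMap IG (IM.prod 𝓘(ℝ, F)) (fun y => (α y, v y)) Y := by
      rw [tangentMap_prodMk (hc1.mdifferentiableAt (by simp)) (hc2.mdifferentiableAt (by simp)),
        tangentMap_prodMk (hαs.mdifferentiable (by simp) _) (hv.mdifferentiableAt (by simp))]
      congr 2
      · rw [← hXY, ← hZ1]
        exact tangentMap_comp_at (g := a) (f := Prod.fst) Z (ha.mdifferentiable (by simp) _)
          mdifferentiableAt_fst
      · conv_rhs => rw [← hZ2]
        exact tangentMap_comp_at (g := v) (f := Prod.snd) Z (hv.mdifferentiableAt (by simp))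
          mdifferentiableAt_snd
    rw [e1, e2, ← tangentMap_comp_at (g := Ψ) (f := fun y => (α y, v y)) Y
      (hΨ.mdifferentiableAt (by simp))
      ((hαs.mdifferentiable (by simp) _).prodMk (hv.mdifferentiableAt (by simp))),
      tangentMap_congr_of_eventuallyEq (f := Ψ ∘ fun y => (α y, v y)) (g := id) hl,
      tangentMap_id, id]
  have hcr : ∀ᶠ z in 𝓝 Z.1, α (d z) = a z.1 := by
    have := hc.continuousAt.tendsto
    rw [hc0] at this
    exact (this.eventually hr).mono fun z hz => hz.1
  obtain ⟨k, hk, hkr⟩ := h.hasSmoothLocalInverses.exists_contMDiffAt_lift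
    (contMDiffAt_fst.prodMk hd) (hcr.mono fun z hz => by
      obtain ⟨w, hw1, hw2⟩ := (h.eq_iff z.1 (d z)).1 hz.symm
      exact ⟨w, Prod.ext hw1 hw2⟩)
  refine ⟨tangentMap (IG.prod IG) IP k Z, ?_, ?_⟩
  · rw [← tangentMap_comp_at (g := p) (f := k) Z (h.contMDiff_left.mdifferentiable (by simp) _)
      (hk.mdifferentiableAt (by simp)),
      tangentMap_congr_of_eventuallyEq (f := p ∘ k) (g := Prod.fst)
        (hkr.mono fun z hz => congrArg Prod.fst hz), hZ1]
  · rw [← tangentMap_comp_at (g := q) (f := k) Z (h.contMDiff_right.mdifferentiable (by simp) _)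
      (hk.mdifferentiableAt (by simp)), tangentMap_congr_of_eventuallyEq (f := q ∘ k) (g := d)
        (hkr.mono fun z hz => congrArg Prod.snd hz), hdZ]

variable [IsManifold IG ∞ G] [IsManifold IP ∞ P] in
/-- The tangent bundle of a fibre product along a submersion is the fibre product of the tangent
bundles. -/
theorem tangentMap (h : IsSmoothFibreProduct IG IP a α p q)
    (ha : ContMDiff IG IM ∞ a) (hα : Manifold.IsSubmersion IG IM ∞ α) :
    IsSmoothFibreProduct IG.tangent IP.tangent (tangentMap IG IM a) (tangentMap IG IM α)
      (tangentMap IP IG p) (tangentMap IP IG q) where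
  contMDiff_left := h.contMDiff_left.tangentMap_infty
  contMDiff_right := h.contMDiff_right.tangentMap_infty
  hasSmoothLocalInverses :=
    h.hasSmoothLocalInverses.tangentMap_prodMk h.contMDiff_left h.contMDiff_right
  eq_iff X Y := by
    refine ⟨h.exists_tangent_lift ha hα, ?_⟩
    rintro ⟨V, rfl, rfl⟩
    rw [← tangentMap_comp_at V (ha.mdifferentiable (by simp) _)
      (h.contMDiff_left.mdifferentiable (by simp) _),
      ← tangentMap_comp_at V (hα.contMDiff.mdifferentiable (by simp) _)
      (h.contMDiff_right.mdifferentiable (by simp) _)]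
    congr 1
    exact funext h.comp_eq

end IsSmoothFibreProduct

end FibreProducts

/-! ### Loopoids: units, opposites and smooth division -/

section Loopoids

open Filter Topology

variable {EG HG G EM HM M EP HP P : Type*}
  [NormedAddCommGroup EG] [NormedSpace ℝ EG] [TopologicalSpace HG]
  [NormedAddCommGroup EM] [NormedSpace ℝ EM] [TopologicalSpace HM]
  [NormedAddCommGroup EP] [NormedSpace ℝ EP] [TopologicalSpace HP]
  {IG : ModelWithCorners ℝ EG HG} {IM : ModelWithCorners ℝ EM HM} {IP : ModelWithCorners ℝ EP HP}
  [TopologicalSpace G] [ChartedSpace HG G]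
  [TopologicalSpace M] [ChartedSpace HM M]
  [TopologicalSpace P] [ChartedSpace HP P]
  {α β : G → M} {ε : M → G} {p₁ p₂ m : P → G}

namespace IsSmoothQuasiloopoid

section

variable (h : IsSmoothQuasiloopoid IG IM IP α β ε p₁ p₂ m)
include h

theorem isSmoothFibreProduct [IP.Boundaryless] : IsSmoothFibreProduct IG IP β α p₁ p₂ where
  contMDiff_left := h.comp_embedding.contMDiff.fst
  contMDiff_right := h.comp_embedding.contMDiff.snd
  hasSmoothLocalInverses := h.comp_embedding.hasSmoothLocalInverses
  eq_iff x y := by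
    have := Set.ext_iff.1 h.comp_range (x, y)
    simp only [mem_range, mem_ofPred_eq, Prod.mk.injEq] at this
    exact this.symm

theorem comp_eq (z : P) : β (p₁ z) = α (p₂ z) :=
  h.comp_range.subset (mem_range_self z)

theorem exists_comp {x y : G} (hxy : β x = α y) : ∃ z, p₁ z = x ∧ p₂ z = y := by
  have : (x, y) ∈ {x : G × G | β x.1 = α x.2} := hxy
  rw [← h.comp_range] at this
  exact this.imp fun z hz => Prod.ext_iff.1 hz

theorem mulRel_unique {x y k k' : G} (hk : MulRel p₁ p₂ m x y k) (hk' : MulRel p₁ p₂ m x y k') :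
    k = k' := by
  obtain ⟨z, rfl, rfl, rfl⟩ := hk
  obtain ⟨w, h1, h2, rfl⟩ := hk'
  rw [h.comp_embedding.isEmbedding.injective (Prod.ext h1 h2)]

theorem source_eq_target_of_mulRel {x y k : G} (hk : MulRel p₁ p₂ m x y k) : β x = α y := by
  obtain ⟨z, rfl, rfl, rfl⟩ := hk
  exact h.comp_eq z

theorem target_unit (x : M) : α (ε x) = x := by
  obtain ⟨g, rfl⟩ := h.source_surjective x
  exact (h.source_eq_target_of_mulRel (h.mul_source g)).symm

theorem source_unit (x : M) : β (ε x) = x := by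
  obtain ⟨g, rfl⟩ := h.target_surjective x
  exact h.source_eq_target_of_mulRel (h.target_mul g)

theorem unit_mul_iff {x : M} {y k : G} : MulRel p₁ p₂ m (ε x) y k ↔ x = α y ∧ k = y := by
  constructor
  · intro hk
    have e := h.source_eq_target_of_mulRel hk
    rw [h.source_unit] at e
    subst e
    exact ⟨rfl, h.mulRel_unique hk (h.target_mul y)⟩
  · rintro ⟨rfl, rfl⟩
    exact h.target_mul k

theorem mul_unit_iff {x : G} {y : M} {k : G} : MulRel p₁ p₂ m x (ε y) k ↔ β x = y ∧ k = x := by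
  constructor
  · intro hk
    have e := h.source_eq_target_of_mulRel hk
    rw [h.target_unit] at e
    subst e
    exact ⟨rfl, h.mulRel_unique hk (h.mul_source x)⟩
  · rintro ⟨rfl, rfl⟩
    exact h.mul_source k

/-- For a quasiloopoid, unities associativity says no more than that the target of a product is the
target of its left factor and its source the source of its right factor. -/
theorem units_assoc_of_target_mul (hα : ∀ z, α (m z) = α (p₁ z)) (hβ : ∀ z, β (m z) = β (p₂ z))
    (x y z : G) (hu : x ∈ range ε ∨ y ∈ range ε ∨ z ∈ range ε) (k : G) :
    (∃ u, MulRel p₁ p₂ m x y u ∧ MulRel p₁ p₂ m u z k) ↔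
      (∃ v, MulRel p₁ p₂ m y z v ∧ MulRel p₁ p₂ m x v k) := by
  rcases hu with ⟨s, rfl⟩ | ⟨s, rfl⟩ | ⟨s, rfl⟩
  · simp only [h.unit_mul_iff]
    constructor
    · rintro ⟨u, ⟨rfl, rfl⟩, w, rfl, rfl, rfl⟩
      exact ⟨m w, ⟨w, rfl, rfl, rfl⟩, (hα w).symm, rfl⟩
    · rintro ⟨v, ⟨w, rfl, rfl, rfl⟩, rfl, rfl⟩
      exact ⟨p₁ w, ⟨hα w, rfl⟩, w, rfl, rfl, rfl⟩
  · simp only [h.unit_mul_iff, h.mul_unit_iff]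
    constructor
    · rintro ⟨u, ⟨rfl, rfl⟩, hk⟩
      exact ⟨z, ⟨h.source_eq_target_of_mulRel hk, rfl⟩, hk⟩
    · rintro ⟨v, ⟨rfl, rfl⟩, hk⟩
      exact ⟨x, ⟨h.source_eq_target_of_mulRel hk, rfl⟩, hk⟩
  · simp only [h.mul_unit_iff]
    constructor
    · rintro ⟨u, ⟨w, rfl, rfl, rfl⟩, rfl, rfl⟩
      exact ⟨p₂ w, ⟨(hβ w).symm, rfl⟩, w, rfl, rfl, rfl⟩
    · rintro ⟨v, ⟨rfl, rfl⟩, w, rfl, rfl, rfl⟩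
      exact ⟨m w, ⟨w, rfl, rfl, rfl⟩, hβ w, rfl⟩

end

end IsSmoothQuasiloopoid

omit [TopologicalSpace G] [ChartedSpace HG G] [TopologicalSpace M] [ChartedSpace HM M]
  [TopologicalSpace P] [ChartedSpace HP P] in
theorem mulRel_swap {x y k : G} : MulRel p₂ p₁ m y x k ↔ MulRel p₁ p₂ m x y k :=
  ⟨fun ⟨z, h1, h2, h3⟩ => ⟨z, h2, h1, h3⟩, fun ⟨z, h1, h2, h3⟩ => ⟨z, h2, h1, h3⟩⟩

/-- The opposite loopoid, with multiplication `(g, h) ↦ h g`. -/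
theorem IsSmoothLoopoid.op [IG.Boundaryless] [IsManifold IG ∞ G]
    (h : IsSmoothLoopoid IG IM IP α β ε p₁ p₂ m) : IsSmoothLoopoid IG IM IP β α ε p₂ p₁ m where
  t2_total := h.t2_total
  secondCountable_total := h.secondCountable_total
  t2_base := h.t2_base
  secondCountable_base := h.secondCountable_base
  target_surjective := h.source_surjective
  target_submersion := h.source_submersion
  source_surjective := h.target_surjective
  source_submersion := h.target_submersion
  units_embedding := h.units_embedding
  comp_embedding := ⟨h.comp_embedding.isImmersion.equiv_comp (Equiv.prodComm G G)
    (contMDiff_snd.prodMk contMDiff_fst) (contMDiff_snd.prodMk contMDiff_fst)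
    (ContinuousLinearEquiv.prodComm ℝ EG EG),
    (Homeomorph.prodComm G G).isEmbedding.comp h.comp_embedding.isEmbedding⟩
  comp_closed := by
    convert h.comp_closed.preimage continuous_swap using 1
    ext x
    exact eq_comm
  comp_range := by
    ext ⟨x, y⟩
    have := Set.ext_iff.1 h.comp_range (y, x)
    simp only [mem_range, mem_ofPred_eq, Prod.mk.injEq] at this ⊢
    rw [eq_comm (a := α x), ← this]
    exact exists_congr fun z => and_comm
  mul_smooth := h.mul_smooth
  mul_source g := mulRel_swap.2 (h.target_mul g)
  target_mul g := mulRel_swap.2 (h.mul_source g)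
  left_injective := h.right_injective
  right_injective := h.left_injective
  left_immersion := h.right_immersion
  right_immersion := h.left_immersion
  units_assoc x y z hu k := by
    simp only [mulRel_swap (p₁ := p₁)]
    exact (h.units_assoc z y x (by tauto) k).symm
  left_diffeo g := by
    simp only [mulRel_swap (p₁ := p₁)]
    exact h.right_diffeo g
  right_diffeo g := by
    simp only [mulRel_swap (p₁ := p₁)]
    exact h.left_diffeo g

namespace IsSmoothLoopoid

section

variable (h : IsSmoothLoopoid IG IM IP α β ε p₁ p₂ m)
include h

/-- The target of a product is the target of its left factor, as `l_g` maps into `α⁻¹(α g)`. -/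
theorem target_comp (z : P) : α (m z) = α (p₁ z) := by
  obtain ⟨l, hl, hm, -⟩ := h.left_diffeo (p₁ z)
  have := hm (show p₂ z ∈ α ⁻¹' {β (p₁ z)} from (h.comp_eq z).symm)
  rwa [hl (p₂ z) (m z) ⟨z, rfl, rfl, rfl⟩] at this

/-- The source of a product is the source of its right factor, as `r_h` maps into `β⁻¹(β h)`. -/
theorem source_comp (z : P) : β (m z) = β (p₂ z) := by
  obtain ⟨l, hl, hm, -⟩ := h.right_diffeo (p₂ z)
  have := hm (show p₁ z ∈ β ⁻¹' {α (p₂ z)} from h.comp_eq z)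
  rwa [hl (p₁ z) (m z) ⟨z, rfl, rfl, rfl⟩] at this

/-- Left divisibility: `x y = k` can be solved for `y` when `x` and `k` have the same target. -/
theorem exists_left_quotient {x k : G} (hk : α x = α k) : ∃ z, p₁ z = x ∧ m z = k := by
  obtain ⟨l, hl, hm, -, l', hm', hinv, -⟩ := h.left_diffeo x
  have hk' : k ∈ α ⁻¹' {α x} := hk.symm
  obtain ⟨z, hz1, hz2⟩ := h.exists_comp (x := x) (y := l' k) (hm' hk').symm
  refine ⟨z, hz1, ?_⟩
  rw [← hl (l' k) (m z) ⟨z, hz1, hz2, rfl⟩, hinv.2 hk']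

end

variable [FiniteDimensional ℝ EG] [IG.Boundaryless] [IP.Boundaryless]

omit [FiniteDimensional ℝ EG] [IG.Boundaryless] [IP.Boundaryless] in
theorem eq_of_left_eq (h : IsSmoothLoopoid IG IM IP α β ε p₁ p₂ m) {z w : P}
    (h₁ : p₁ z = p₁ w) (h₂ : m z = m w) : z = w :=
  h.comp_embedding.isEmbedding.injective (Prod.ext h₁ (h.left_injective z w h₁ h₂))

/-- Vectors tangent to the `α`-fibre at `g h` are images of vectors tangent to the `α`-fibre at
`h` under the derivative of `l_g`. The inverse `l'` of `l_g` is only known to be smooth on the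
fibre, so it is precomposed with a local retraction `κ` of `G` onto the fibre. -/
theorem exists_mfderiv_eq_of_target_eq_zero (h : IsSmoothLoopoid IG IM IP α β ε p₁ p₂ m) (z : P)
    (K : TangentSpace IG (m z)) (hK : mfderiv IG IM α (m z) K = 0) :
    ∃ V : TangentSpace IP z, mfderiv IP IG p₁ z V = 0 ∧ mfderiv IP IG m z V = K := by
  have hj := h.isSmoothFibreProduct
  have hαs := h.target_submersion.contMDiff
  obtain ⟨F, _, _, _, v, Ψ, hv, hΨ, hl, hr⟩ := h.target_submersion.exists_local_trivialization (m z)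
  obtain ⟨l, hlm, hm, -, l', hm', hinv, hl's⟩ := h.left_diffeo (p₁ z)
  let κ : G → G := fun y => Ψ (α (m z), v y)
  have hc : ContMDiffAt IG (IM.prod 𝓘(ℝ, F)) ∞ (fun y => (α (m z), v y)) (m z) :=
    contMDiffAt_const.prodMk hv
  have hκ : ContMDiffAt IG IG ∞ κ (m z) :=
    ContMDiffAt.comp (g := Ψ) (f := fun y => (α (m z), v y)) (m z) hΨ hc
  have hκz : κ (m z) = m z := hl.self_of_nhds
  have hκB : ∀ᶠ y in 𝓝 (m z), κ y ∈ α ⁻¹' {α (p₁ z)} := by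
    filter_upwards [hc.continuousAt.eventually hr] with y hy
    exact hy.1.trans (h.target_comp z)
  let X : TangentBundle IG G := ⟨m z, K⟩
  have hX : tangentMap IG IM α X = ⟨α (m z), 0⟩ :=
    congrArg (Bundle.TotalSpace.mk (α (m z))) hK
  have hκX : tangentMap IG IG κ X = X := by
    have e1 : tangentMap IG IG κ X = tangentMap (IM.prod 𝓘(ℝ, F)) IG Ψ
        (tangentMap IG (IM.prod 𝓘(ℝ, F)) (fun y => (α (m z), v y)) X) :=
      tangentMap_comp_at (g := Ψ) (f := fun y => (α (m z), v y)) X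
        (hΨ.mdifferentiableAt (by simp)) (hc.mdifferentiableAt (by simp))
    have e2 : tangentMap IG (IM.prod 𝓘(ℝ, F)) (fun y => (α (m z), v y)) X =
        tangentMap IG (IM.prod 𝓘(ℝ, F)) (fun y => (α y, v y)) X := by
      rw [tangentMap_prodMk (mdifferentiableAt_const) (hv.mdifferentiableAt (by simp)),
        tangentMap_prodMk (hαs.mdifferentiable (by simp) _) (hv.mdifferentiableAt (by simp)), hX]
      congr 2
      simp [tangentMap, mfderiv_const]
    rw [e1, e2, ← tangentMap_comp_at (g := Ψ) (f := fun y => (α y, v y)) X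
      (hΨ.mdifferentiableAt (by simp))
      ((hαs.mdifferentiable (by simp) _).prodMk (hv.mdifferentiableAt (by simp))),
      tangentMap_congr_of_eventuallyEq (X := X) (f := Ψ ∘ fun y => (α y, v y)) (g := id) hl,
      tangentMap_id, id]
  have hl'κ : ContMDiffAt IG IG ∞ (l' ∘ κ) (m z) := by
    have hB : κ (m z) ∈ α ⁻¹' {α (p₁ z)} := hκB.self_of_nhds
    exact ((hl's _ hB).comp (m z) (s := κ ⁻¹' (α ⁻¹' {α (p₁ z)})) hκ.contMDiffWithinAt
      fun _ hy => hy).contMDiffAt hκB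
  obtain ⟨k, hk, hkr⟩ := hj.hasSmoothLocalInverses.exists_contMDiffAt_lift
    (g := fun y => (p₁ z, l' (κ y))) (contMDiffAt_const.prodMk hl'κ) (hκB.mono fun y hy => by
      obtain ⟨w, hw1, hw2⟩ := h.exists_comp (x := p₁ z) (y := l' (κ y)) (hm' hy).symm
      exact ⟨w, Prod.ext hw1 hw2⟩)
  have hk1 : ∀ᶠ y in 𝓝 (m z), p₁ (k y) = p₁ z := hkr.mono fun y hy => congrArg Prod.fst hy
  have hk2 : ∀ᶠ y in 𝓝 (m z), m (k y) = κ y := by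
    filter_upwards [hkr, hκB] with y hy hyB
    rw [← hlm (p₂ (k y)) (m (k y)) ⟨k y, congrArg Prod.fst hy, rfl, rfl⟩,
      show p₂ (k y) = l' (κ y) from congrArg Prod.snd hy, hinv.2 hyB]
  have hkz : k (m z) = z := h.eq_of_left_eq hk1.self_of_nhds (hk2.self_of_nhds.trans hκz)
  have hV1 : tangentMap IP IG p₁ (tangentMap IG IP k X) = ⟨p₁ z, 0⟩ := by
    rw [← tangentMap_comp_at (g := p₁) (f := k) X (hj.contMDiff_left.mdifferentiable (by simp) _)
      (hk.mdifferentiableAt (by simp)),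
      tangentMap_congr_of_eventuallyEq (X := X) (f := p₁ ∘ k) (g := fun _ => p₁ z) hk1]
    simp [tangentMap, mfderiv_const]
  have hV2 : tangentMap IP IG m (tangentMap IG IP k X) = ⟨m z, K⟩ := by
    rw [← tangentMap_comp_at (g := m) (f := k) X (h.mul_smooth.mdifferentiable (by simp) _)
      (hk.mdifferentiableAt (by simp)),
      tangentMap_congr_of_eventuallyEq (X := X) (f := m ∘ k) (g := κ) hk2, hκX]
  have hVz : (tangentMap IG IP k X).1 = z := hkz
  clear_value X
  generalize tangentMap IG IP k X = V at hV1 hV2 hVz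
  obtain ⟨w, V⟩ := V
  obtain rfl : w = z := hVz
  exact ⟨V, eq_of_heq (Bundle.TotalSpace.mk.inj hV1).2, eq_of_heq (Bundle.TotalSpace.mk.inj hV2).2⟩

/-- Infinitesimal left divisibility: the equation `X V = K` can be solved for tangent vectors. -/
theorem exists_tangent_left_quotient (h : IsSmoothLoopoid IG IM IP α β ε p₁ p₂ m)
    {X K : TangentBundle IG G} (hXK : tangentMap IG IM α X = tangentMap IG IM α K) :
    ∃ V : TangentBundle IP P, tangentMap IP IG p₁ V = X ∧ tangentMap IP IG m V = K := by
  have hj := h.isSmoothFibreProduct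
  have hαs := h.target_submersion.contMDiff
  have hb : α X.1 = α K.1 := congrArg (fun Z => Z.1) hXK
  obtain ⟨z, hz1, hz2⟩ := h.exists_left_quotient hb
  -- a vector `V₀` at `z` over `X`, whose product is corrected by a vector tangent to the fibre
  obtain ⟨Y, hYz, hY⟩ := h.target_submersion.exists_tangentMap_eq (p₂ z) (tangentMap IG IM β X)
    (by rw [← h.comp_eq, hz1]; rfl)
  obtain ⟨V₀, hV1, hV2⟩ := hj.exists_tangent_lift h.source_submersion.contMDiff
    h.target_submersion hY.symm
  have hV0z : V₀.1 = z := by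
    refine hj.ext ?_ ?_
    · rw [hz1, ← hV1]; rfl
    · rw [← hYz, ← hV2]; rfl
  obtain ⟨w, V₀⟩ := V₀
  obtain rfl : w = z := hV0z
  obtain ⟨k, K⟩ := K
  obtain rfl : m w = k := hz2
  have hd : tangentMap IG IM α (tangentMap IP IG m ⟨w, V₀⟩) = tangentMap IG IM α ⟨m w, K⟩ := by
    rw [← hXK, ← hV1, ← tangentMap_comp_at _ (hαs.mdifferentiable (by simp) _)
      (h.mul_smooth.mdifferentiable (by simp) _),
      ← tangentMap_comp_at _ (hαs.mdifferentiable (by simp) _)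
      (hj.contMDiff_left.mdifferentiable (by simp) _)]
    congr 1
    exact funext h.target_comp
  have hd' : mfderiv IG IM α (m w) (mfderiv IP IG m w V₀) = mfderiv IG IM α (m w) K :=
    eq_of_heq (Bundle.TotalSpace.mk.inj hd).2
  obtain ⟨V₁, h1, h2⟩ := h.exists_mfderiv_eq_of_target_eq_zero w (K - mfderiv IP IG m w V₀)
    (by rw [map_sub, hd', sub_self])
  refine ⟨⟨w, V₀ + V₁⟩, ?_, ?_⟩
  · rw [← hV1]
    refine congrArg (Bundle.TotalSpace.mk (p₁ w)) ?_
    change mfderiv IP IG p₁ w (V₀ + V₁) = mfderiv IP IG p₁ w V₀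
    rw [map_add, h1, add_zero]
  · refine congrArg (Bundle.TotalSpace.mk (m w)) ?_
    change mfderiv IP IG m w (V₀ + V₁) = K
    rw [map_add, h2, add_sub_cancel]

/-- Left division is smooth: `(p₁, m)` presents the manifold of composable pairs as the fibre
product of `α` with itself. The translations are diffeomorphisms for each fixed `g`; joint
smoothness of the inverse comes from the inverse function theorem for `w ↦ (p₁ w, v (m w))`, where
`v` is the fibre coordinate of a local trivialization of `α`. -/
theorem isSmoothFibreProduct_left [FiniteDimensional ℝ EP] [IsManifold IP ∞ P]
    (h : IsSmoothLoopoid IG IM IP α β ε p₁ p₂ m) : IsSmoothFibreProduct IG IP α α p₁ m where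
  contMDiff_left := h.isSmoothFibreProduct.contMDiff_left
  contMDiff_right := h.mul_smooth
  eq_iff x y := by
    refine ⟨h.exists_left_quotient, ?_⟩
    rintro ⟨z, rfl, rfl⟩
    exact (h.target_comp z).symm
  hasSmoothLocalInverses := by
    intro z
    have hp := h.isSmoothFibreProduct.contMDiff_left
    have hαs := h.target_submersion.contMDiff
    obtain ⟨F, _, _, _, v, Ψ, hv, hΨ, hl, hr⟩ :=
      h.target_submersion.exists_local_trivialization (m z)
    let Φ : P → G × F := fun w => (p₁ w, v (m w))
    have hvm : ContMDiffAt IP 𝓘(ℝ, F) ∞ (fun w => v (m w)) z :=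
      ContMDiffAt.comp (g := v) (f := m) z hv h.mul_smooth.contMDiffAt
    have hΦ : ContMDiffAt IP (IG.prod 𝓘(ℝ, F)) ∞ Φ z := hp.contMDiffAt.prodMk hvm
    -- the product is recovered from `Φ` by `m w = Ψ (α (p₁ w), v (m w))`
    let c : G × F → M × F := fun x => (α x.1, x.2)
    have hc : ContMDiff (IG.prod 𝓘(ℝ, F)) (IM.prod 𝓘(ℝ, F)) ∞ c :=
      (hαs.comp contMDiff_fst).prodMk contMDiff_snd
    have hcz : c (Φ z) = (α (m z), v (m z)) := Prod.ext (h.target_comp z).symm rfl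
    have hΨc : ContMDiffAt (IG.prod 𝓘(ℝ, F)) IG ∞ (Ψ ∘ c) (Φ z) :=
      ContMDiffAt.comp _ (hcz ▸ hΨ) hc.contMDiffAt
    have hmΦ : m =ᶠ[𝓝 z] (Ψ ∘ c) ∘ Φ := by
      filter_upwards [h.mul_smooth.continuous.continuousAt.eventually hl] with w hw
      simp only [Function.comp_apply, Φ, c, ← h.target_comp]
      exact hw.symm
    have hinj : Function.Injective (mfderiv IP (IG.prod 𝓘(ℝ, F)) Φ z) := by
      rw [injective_iff_map_eq_zero]
      intro V hV
      have e1 : p₁ = Prod.fst ∘ Φ := rfl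
      apply h.left_immersion z V
      · rw [e1, mfderiv_comp z mdifferentiableAt_fst (hΦ.mdifferentiableAt (by simp))]
        exact (congrArg _ hV).trans (ContinuousLinearMap.map_zero _)
      · rw [hmΦ.mfderiv_eq, mfderiv_comp z (hΨc.mdifferentiableAt (by simp))
          (hΦ.mdifferentiableAt (by simp))]
        exact (congrArg _ hV).trans
          (mfderiv (IG.prod 𝓘(ℝ, F)) IG (Ψ ∘ c) (Φ z)).map_zero
    have hsurj : Function.Surjective (mfderiv IP (IG.prod 𝓘(ℝ, F)) Φ z) := by
      intro W
      let W' : TangentBundle (IG.prod 𝓘(ℝ, F)) (G × F) := ⟨Φ z, W⟩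
      have hcr : ∀ᶠ x in 𝓝 (Φ z), α ((Ψ ∘ c) x) = α x.1 ∧ v ((Ψ ∘ c) x) = x.2 := by
        have := hc.continuous.tendsto (Φ z)
        rw [hcz] at this
        exact this.eventually hr
      have hKm : (Ψ ∘ c) (Φ z) = m z := hmΦ.self_of_nhds.symm
      have hvK : MDifferentiableAt IG 𝓘(ℝ, F) v ((Ψ ∘ c) (Φ z)) :=
        hKm ▸ hv.mdifferentiableAt (by simp)
      have hK : MDifferentiableAt (IG.prod 𝓘(ℝ, F)) IG (Ψ ∘ c) (Φ z) :=
        hΨc.mdifferentiableAt (by simp)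
      obtain ⟨V, hV1, hV2⟩ := h.exists_tangent_left_quotient
        (X := tangentMap (IG.prod 𝓘(ℝ, F)) IG Prod.fst W')
        (K := tangentMap (IG.prod 𝓘(ℝ, F)) IG (Ψ ∘ c) W') (by
          rw [← tangentMap_comp_at W' (hαs.mdifferentiable (by simp) _) hK,
            ← tangentMap_comp_at W' (hαs.mdifferentiable (by simp) _) mdifferentiableAt_fst]
          exact tangentMap_congr_of_eventuallyEq (X := W') (hcr.mono fun x hx => hx.1.symm))
      have hVz : V.1 = z := by
        refine h.eq_of_left_eq ?_ ?_
        · exact congrArg (fun Z => Z.1) hV1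
        · exact (congrArg (fun Z => Z.1) hV2).trans hKm
      obtain ⟨w, V⟩ := V
      obtain rfl : w = z := hVz
      have e3 : tangentMap IP 𝓘(ℝ, F) (fun w => v (m w)) ⟨w, V⟩ =
          tangentMap (IG.prod 𝓘(ℝ, F)) 𝓘(ℝ, F) Prod.snd W' := by
        have : tangentMap IP 𝓘(ℝ, F) (fun w => v (m w)) ⟨w, V⟩ =
            tangentMap IG 𝓘(ℝ, F) v (tangentMap IP IG m ⟨w, V⟩) :=
          tangentMap_comp_at (g := v) (f := m) ⟨w, V⟩ (hv.mdifferentiableAt (by simp))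
            (h.mul_smooth.mdifferentiable (by simp) _)
        rw [this, hV2, ← tangentMap_comp_at W' hvK hK]
        exact tangentMap_congr_of_eventuallyEq (X := W') (hcr.mono fun x hx => hx.2)
      have hfin : tangentMap IP (IG.prod 𝓘(ℝ, F)) Φ ⟨w, V⟩ = W' := by
        rw [tangentMap_prodMk (hp.mdifferentiable (by simp) _) (hvm.mdifferentiableAt (by simp)),
          e3, hV1, tangentMap_prodFst, tangentMap_prodSnd]
        rfl
      exact ⟨V, eq_of_heq (Bundle.TotalSpace.mk.inj hfin).2⟩
    obtain ⟨Ξ, hΞ, hΞz, hΞr⟩ := hΦ.exists_local_right_inverse ⟨hinj, hsurj⟩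
    let e : G × G → G × F := fun x => (x.1, v x.2)
    have hez : e (p₁ z, m z) = Φ z := rfl
    have he : ContMDiffAt (IG.prod IG) (IG.prod 𝓘(ℝ, F)) ∞ e (p₁ z, m z) :=
      contMDiffAt_fst.prodMk (ContMDiffAt.comp (g := v) (f := Prod.snd) (p₁ z, m z) hv
        contMDiffAt_snd)
    have hΞe : ContMDiffAt (IG.prod IG) IP ∞ (Ξ ∘ e) (p₁ z, m z) :=
      ContMDiffAt.comp (p₁ z, m z) hΞ he
    refine ⟨Ξ ∘ e, hΞe, ?_⟩
    have t1 : Tendsto (fun x => m (Ξ (e x))) (𝓝 (p₁ z, m z)) (𝓝 (m z)) := by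
      have := (h.mul_smooth.continuous.continuousAt.comp hΞe.continuousAt).tendsto
      simp only [Function.comp_apply, hez, hΞz] at this
      exact this
    filter_upwards [he.continuousAt.eventually hΞr, t1.eventually hl,
      (continuousAt_snd (p := (p₁ z, m z))).eventually hl]
    rintro _ hx hx1 hx2 q rfl
    have h1 : p₁ (Ξ (e (p₁ q, m q))) = p₁ q := congrArg Prod.fst hx
    have h2 : v (m (Ξ (e (p₁ q, m q)))) = v (m q) := congrArg Prod.snd hx
    refine h.eq_of_left_eq h1 ?_
    rw [Function.comp_apply, ← hx1, h2, h.target_comp, h1, ← h.target_comp, hx2]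

end IsSmoothLoopoid

end Loopoids

/-! ### The tangent loopoid -/

section TangentLoopoid

open Filter Topology

variable {EG HG G EM HM M EP HP P : Type*}
  [NormedAddCommGroup EG] [NormedSpace ℝ EG] [TopologicalSpace HG]
  [NormedAddCommGroup EM] [NormedSpace ℝ EM] [TopologicalSpace HM]
  [NormedAddCommGroup EP] [NormedSpace ℝ EP] [TopologicalSpace HP]
  {IG : ModelWithCorners ℝ EG HG} {IM : ModelWithCorners ℝ EM HM} {IP : ModelWithCorners ℝ EP HP}
  [TopologicalSpace G] [ChartedSpace HG G]
  [TopologicalSpace M] [ChartedSpace HM M]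
  [TopologicalSpace P] [ChartedSpace HP P]
  {α β : G → M} {ε : M → G} {p₁ p₂ m : P → G} {ι : G → G}

omit [TopologicalSpace M] in
/-- A multiplicative relation between smooth maps is inherited by their tangent maps: as the
manifold of composable pairs is embedded, the pair of factors is a smooth map into it. -/
theorem IsSmoothFibreProduct.mulRel_tangentMap {EN HN N : Type*} [NormedAddCommGroup EN]
    [NormedSpace ℝ EN] [TopologicalSpace HN] {IN : ModelWithCorners ℝ EN HN} [TopologicalSpace N]
    [ChartedSpace HN N] (h : IsSmoothFibreProduct IG IP β α p₁ p₂) (hm : ContMDiff IP IG ∞ m)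
    {a b c : N → G} (ha : ContMDiff IN IG ∞ a) (hb : ContMDiff IN IG ∞ b)
    (habc : ∀ n, MulRel p₁ p₂ m (a n) (b n) (c n)) (X : TangentBundle IN N) :
    MulRel (_root_.tangentMap IP IG p₁) (_root_.tangentMap IP IG p₂) (_root_.tangentMap IP IG m)
      (_root_.tangentMap IN IG a X) (_root_.tangentMap IN IG b X)
      (_root_.tangentMap IN IG c X) := by
  choose s hs1 hs2 hs3 using habc
  have hs : ContMDiff IN IP ∞ s := fun n =>
    h.hasSmoothLocalInverses.contMDiffAt_lift ((ha.prodMk hb) n)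
      (Eventually.of_forall fun n => Prod.ext (hs1 n) (hs2 n))
  have hsX := hs.mdifferentiable (by simp) X.1
  refine ⟨_root_.tangentMap IN IP s X, ?_, ?_, ?_⟩
  · rw [← tangentMap_comp_at X (h.contMDiff_left.mdifferentiable (by simp) _) hsX]
    exact congrArg (_root_.tangentMap IN IG · X) (funext hs1)
  · rw [← tangentMap_comp_at X (h.contMDiff_right.mdifferentiable (by simp) _) hsX]
    exact congrArg (_root_.tangentMap IN IG · X) (funext hs2)
  · rw [← tangentMap_comp_at X (hm.mdifferentiable (by simp) _) hsX]
    exact congrArg (_root_.tangentMap IN IG · X) (funext hs3)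

omit [TopologicalSpace M] in
/-- The two projections of a fibre product have no common kernel. -/
theorem IsSmoothFibreProduct.eq_zero_of_mfderiv_eq_zero
    {a : G → M} (h : IsSmoothFibreProduct IG IP a α p₁ p₂) (z : P) (v : TangentSpace IP z)
    (h₁ : mfderiv IP IG p₁ z v = 0) (h₂ : mfderiv IP IG p₂ z v = 0) : v = 0 := by
  apply h.hasSmoothLocalInverses.mfderiv_injective (h.contMDiff_left.prodMk h.contMDiff_right) z
  have e : mfderiv IP (IG.prod IG) (fun z => (p₁ z, p₂ z)) z v = 0 := by
    rw [mfderiv_prodMk (h.contMDiff_left.mdifferentiable (by simp) _)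
      (h.contMDiff_right.mdifferentiable (by simp) _)]
    exact Prod.ext h₁ h₂
  exact e.trans (ContinuousLinearMap.map_zero _).symm

variable [FiniteDimensional ℝ EG] [IG.Boundaryless] [IsManifold IG ∞ G]
  [FiniteDimensional ℝ EM] [IM.Boundaryless] [IsManifold IM ∞ M]
  [FiniteDimensional ℝ EP] [IP.Boundaryless] [IsManifold IP ∞ P]

namespace IsSmoothLoopoid

theorem tangent_isSmoothQuasiloopoid (h : IsSmoothLoopoid IG IM IP α β ε p₁ p₂ m) :
    IsSmoothQuasiloopoid IG.tangent IM.tangent IP.tangent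
      (tangentMap IG IM α) (tangentMap IG IM β) (tangentMap IM IG ε)
      (tangentMap IP IG p₁) (tangentMap IP IG p₂) (tangentMap IP IG m) := by
  have hα := h.target_submersion
  have hβ := h.source_submersion
  have hαd := hα.contMDiff.mdifferentiable (n := ∞) (by simp)
  have hβd := hβ.contMDiff.mdifferentiable (n := ∞) (by simp)
  have hε := h.units_embedding.contMDiff
  have hεd := hε.mdifferentiable (n := ∞) (by simp)
  have hj := h.isSmoothFibreProduct
  have Tj := hj.tangentMap hβ.contMDiff hα
  have Tl := h.isSmoothFibreProduct_left.tangentMap hα.contMDiff hα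
  have Tr := h.op.isSmoothFibreProduct_left.tangentMap hβ.contMDiff hβ
  have := h.t2_total
  have := h.t2_base
  have := h.secondCountable_total
  have := h.secondCountable_base
  have T2 : T2Space (TangentBundle IM M) := TangentBundle.t2Space
  refine
    { t2_total := TangentBundle.t2Space
      secondCountable_total := TangentBundle.secondCountableTopology
      t2_base := T2
      secondCountable_base := TangentBundle.secondCountableTopology
      target_surjective := fun W => ?_
      target_submersion := hα.tangentMap
      source_surjective := fun W => ?_
      source_submersion := hβ.tangentMap
      units_embedding := ⟨h.units_embedding.isImmersion.tangentMap, ?_⟩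
      comp_embedding := ⟨?_, ?_⟩
      comp_closed := ?_
      comp_range := ?_
      mul_smooth := h.mul_smooth.tangentMap_infty
      mul_source := fun X => ?_
      target_mul := fun X => ?_
      left_injective := fun V W h1 h2 => congrArg _ (Tl.ext h1 h2)
      right_injective := fun V W h1 h2 => congrArg _ (Tr.ext h1 h2)
      left_immersion := Tl.eq_zero_of_mfderiv_eq_zero
      right_immersion := Tr.eq_zero_of_mfderiv_eq_zero }
  · obtain ⟨g, hg⟩ := h.target_surjective W.1
    obtain ⟨Y, -, hY⟩ := hα.exists_tangentMap_eq g W hg.symm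
    exact ⟨Y, hY⟩
  · obtain ⟨g, hg⟩ := h.source_surjective W.1
    obtain ⟨Y, -, hY⟩ := hβ.exists_tangentMap_eq g W hg.symm
    exact ⟨Y, hY⟩
  · exact (h.units_embedding.hasSmoothLocalInverses.tangentMap hε).isEmbedding
      hε.tangentMap_infty.continuous
  · refine (h.comp_embedding.isImmersion.tangentMap.equiv_comp (equivTangentBundleProd IG G IG G)
      contMDiff_equivTangentBundleProd contMDiff_equivTangentBundleProd_symm
      (ContinuousLinearEquiv.prodProdProdComm ℝ EG EG EG EG)).congr ?_
    exact funext fun V => equivTangentBundleProd_tangentMap_prodMk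
      (hj.contMDiff_left.mdifferentiable (by simp) _)
      (hj.contMDiff_right.mdifferentiable (by simp) _)
  · exact Tj.hasSmoothLocalInverses.isEmbedding
      (Tj.contMDiff_left.continuous.prodMk Tj.contMDiff_right.continuous)
  · exact isClosed_eq (hβ.contMDiff.tangentMap_infty.continuous.comp continuous_fst)
      (hα.contMDiff.tangentMap_infty.continuous.comp continuous_snd)
  · ext ⟨X, Y⟩
    simpa only [mem_range, mem_ofPred_eq, Prod.mk.injEq] using (Tj.eq_iff X Y).symm
  · have := hj.mulRel_tangentMap h.mul_smooth (c := id) contMDiff_id (hε.comp hβ.contMDiff)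
      h.mul_source X
    rwa [tangentMap_id, tangentMap_comp_at X (hεd _) (hβd _)] at this
  · have := hj.mulRel_tangentMap h.mul_smooth (c := id) (hε.comp hα.contMDiff) contMDiff_id
      h.target_mul X
    rwa [tangentMap_id, tangentMap_comp_at X (hεd _) (hαd _)] at this

theorem tangent (h : IsSmoothLoopoid IG IM IP α β ε p₁ p₂ m) :
    IsSmoothLoopoid IG.tangent IM.tangent IP.tangent
      (tangentMap IG IM α) (tangentMap IG IM β) (tangentMap IM IG ε)
      (tangentMap IP IG p₁) (tangentMap IP IG p₂) (tangentMap IP IG m) := by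
  have hα := h.target_submersion
  have hβ := h.source_submersion
  have hq := h.tangent_isSmoothQuasiloopoid
  have Tl := h.isSmoothFibreProduct_left.tangentMap hα.contMDiff hα
  have Tr := h.op.isSmoothFibreProduct_left.tangentMap hβ.contMDiff hβ
  refine { hq with
    units_assoc := hq.units_assoc_of_target_mul (fun V => (Tl.comp_eq V).symm)
      fun V => (Tr.comp_eq V).symm
    left_diffeo := (h.isSmoothFibreProduct.tangentMap hβ.contMDiff hα).exists_restrictsToDiffeo Tl
    right_diffeo := fun X => ?_ }
  simpa only [mulRel_swap] using
    (h.op.isSmoothFibreProduct.tangentMap hα.contMDiff hβ).exists_restrictsToDiffeo Tr X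

end IsSmoothLoopoid

omit [FiniteDimensional ℝ EG] [IG.Boundaryless] [FiniteDimensional ℝ EP] [IsManifold IP ∞ P]
  [FiniteDimensional ℝ EM] [IM.Boundaryless] [IsManifold IM ∞ M] in
theorem IsSmoothInverse.tangent (hq : IsSmoothQuasiloopoid IG IM IP α β ε p₁ p₂ m)
    (hι : IsSmoothInverse IG p₁ p₂ m ι) :
    IsSmoothInverse IG.tangent (tangentMap IP IG p₁) (tangentMap IP IG p₂) (tangentMap IP IG m)
      (tangentMap IG IG ι) := by
  have hj := hq.isSmoothFibreProduct
  obtain ⟨Φ, rfl⟩ := hι.diffeo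
  have hΦd := Φ.contMDiff.mdifferentiable (n := ∞) (by simp)
  have hΦd' := Φ.symm.contMDiff.mdifferentiable (n := ∞) (by simp)
  refine ⟨⟨⟨⟨tangentMap IG IG Φ, tangentMap IG IG Φ.symm, fun X => ?_, fun X => ?_⟩,
    Φ.contMDiff.tangentMap_infty, Φ.symm.contMDiff.tangentMap_infty⟩, rfl⟩, ?_, ?_⟩
  · rw [← tangentMap_comp_at X (hΦd' _) (hΦd _)]
    have : ⇑Φ.symm ∘ ⇑Φ = id := funext Φ.symm_apply_apply
    rw [this, tangentMap_id, id]
  · rw [← tangentMap_comp_at X (hΦd _) (hΦd' _)]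
    have : ⇑Φ ∘ ⇑Φ.symm = id := funext Φ.apply_symm_apply
    rw [this, tangentMap_id, id]
  · rintro _ _ _ ⟨V, rfl, rfl, rfl⟩
    have := hj.mulRel_tangentMap hq.mul_smooth (Φ.contMDiff.comp hj.contMDiff_left) hq.mul_smooth
      (fun z => hι.inv_mul_cancel_left _ _ _ ⟨z, rfl, rfl, rfl⟩) V
    rwa [tangentMap_comp_at V (hΦd _) (hj.contMDiff_left.mdifferentiable (by simp) _)] at this
  · rintro _ _ _ ⟨V, rfl, rfl, rfl⟩
    have := hj.mulRel_tangentMap hq.mul_smooth hq.mul_smooth (Φ.contMDiff.comp hj.contMDiff_right)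
      (fun z => hι.mul_inv_cancel_right _ _ _ ⟨z, rfl, rfl, rfl⟩) V
    rwa [tangentMap_comp_at V (hΦd _) (hj.contMDiff_right.mdifferentiable (by simp) _)] at this

end TangentLoopoid

/-- Tangent bundle of a smooth loopoid. The manifold of composable pairs of `TG` is the tangent
bundle `TP` of the manifold `P` of composable pairs of `G`, embedded in `TG × TG` by
`(Tp₁, Tp₂)`; so `T(G⁽²⁾) = (TG)⁽²⁾` is part of the conclusion. -/
theorem mainTheorem1 {EG HG G EM HM M EP HP P : Type*}
    [NormedAddCommGroup EG] [NormedSpace ℝ EG] [FiniteDimensional ℝ EG] [TopologicalSpace HG]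
    [NormedAddCommGroup EM] [NormedSpace ℝ EM] [FiniteDimensional ℝ EM] [TopologicalSpace HM]
    [NormedAddCommGroup EP] [NormedSpace ℝ EP] [FiniteDimensional ℝ EP] [TopologicalSpace HP]
    (IG : ModelWithCorners ℝ EG HG) [IG.Boundaryless]
    (IM : ModelWithCorners ℝ EM HM) [IM.Boundaryless]
    (IP : ModelWithCorners ℝ EP HP) [IP.Boundaryless]
    [TopologicalSpace G] [ChartedSpace HG G] [IsManifold IG ∞ G]
    [TopologicalSpace M] [ChartedSpace HM M] [IsManifold IM ∞ M]
    [TopologicalSpace P] [ChartedSpace HP P] [IsManifold IP ∞ P]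
    (α β : G → M) (ε : M → G) (p₁ p₂ m : P → G) :
    (IsSmoothLoopoid IG IM IP α β ε p₁ p₂ m →
      IsSmoothLoopoid IG.tangent IM.tangent IP.tangent
        (tangentMap IG IM α) (tangentMap IG IM β) (tangentMap IM IG ε)
        (tangentMap IP IG p₁) (tangentMap IP IG p₂) (tangentMap IP IG m)) ∧
    (∀ ι : G → G, IsIPLoopoid IG IM IP α β ε p₁ p₂ m ι →
      IsIPLoopoid IG.tangent IM.tangent IP.tangent
        (tangentMap IG IM α) (tangentMap IG IM β) (tangentMap IM IG ε)
        (tangentMap IP IG p₁) (tangentMap IP IG p₂) (tangentMap IP IG m)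
        (tangentMap IG IG ι)) := by
  exact ⟨fun h => h.tangent, fun ι h =>
    { h.toIsSmoothLoopoid.tangent, h.toIsSmoothInverse.tangent h.toIsSmoothQuasiloopoid with }⟩
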